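/- Let $K(x)=\dfrac{x^\perp}{2\pi|x|^2}$, $x^\perp=(-x_2,x_1)$, be the Biot–Savart kernel on $\mathbb R^2$. For $\kappa\ge 0$ let $L^2(\log L)^\kappa$ be the Zygmund space of all $f\in L^1_{\rm loc}(\mathbb R^2)$ with $\int_{\mathbb R^2} A_{2,\kappa}(|f|)\,dx<\infty$, where $A_{2,\kappa}(s)=[s\log^\kappa(2+s)]^2$, with the Luxemburg norm $\|f\|_{2,\kappa}=\inf\{k>0:\int A_{2,\kappa}(|f|/k)\,dx\le 1\}$. For a function space $X$ let $X_c$ be the set of its elements with compact support. For $\tfrac12<\alpha\le\tfrac23$ let $$\omega^\alpha_+(x)=\frac{1}{|x|\,|\log|x||^{\alpha}}\quad\text{if } |x|<\tfrac13,\ x_2>0,\qquad \omega^\alpha_+(x)=0\ \text{ otherwise},$$ and for integers $n\ge 2$ let $\omega^n_+(x)=0$ if $x_2<0$ and, for $x_2\ge 0$, $$\omega^n_+(x)=\omega^\alpha_+(x)\ \text{ if } |x|>\tfrac1n,\qquad \omega^n_+(x)=\frac{n}{|\log n|^\alpha}\ \text{ if } |x|\le\tfrac1n .$$ (1) Let $\tfrac12<\alpha\le\tfrac23$.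 For every $0\le\kappa<\alpha-\tfrac12$, the functions $\omega^\alpha_+$ and $\omega^n_+$ ($n\ge2$) belong to $L^2(\log L)^\kappa$ and $\|\omega^n_+-\omega^\alpha_+\|_{2,\kappa}\to0$ as $n\to\infty$. (2) Let $\tfrac12<\alpha\le\tfrac23$, and let $u^n_1$ be the first component of $K*\omega^n_+$. For every $n\ge2$ the integral defining $K*\omega^n_+$ converges absolutely at every point, the function $u^n_1|\omega^n_+|^2$ is integrable, and $$\lim_{n\to\infty}\int_{\mathbb R^2}u^n_1\,|\omega^n_+|^2\,dx=+\infty .$$ (3) Let $2<p\le\infty$. For $\omega\in L^p_c(\mathbb R^2)$ the integral defining $u=K*\omega$ converges absolutely at every point and $u|\omega|^2$ is locally integrable, so that $T:\omega\mapsto u|\omega|^2$ maps $L^p_c$ to the space $\mathcal D'(\mathbb R^2;\mathbb R^2)$ of distributions. The map $T$ has no continuous extension to $(L^2(\log L)^\kappa)_c$ for any $0\le\kappa<\tfrac16$, and none to $L^2_c$. In fact, for $X=L^2(\log L)^\kappa$ with $0\le\kappa<\tfrac16$, as well as for $X=L^2$, there is no map $\widetilde T:X_c\to\mathcal D'(\mathbb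 R^2;\mathbb R^2)$ that agrees with $T$ on $L^p_c$ and satisfies $\langle \widetilde T(w_n),\varphi\rangle\to\langle\widetilde T(w),\varphi\rangle$ for all $\varphi\in C^\infty_c(\mathbb R^2)$ whenever $w_n,w\in X_c$ are supported in a common compact set and $w_n\to w$ in the norm of $X$. -/

import Mathlib

open MeasureTheory Filter Topology
open scoped ENNReal NNReal Distributions

/-- The plane `ℝ²` with its Euclidean norm; the coordinates `x₁, x₂` are
`x 0`, `x 1`. -/
abbrev Plane : Type := EuclideanSpace ℝ (Fin 2)

noncomputable section

/-! ### The Biot-Savart law -/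

/-- The Biot-Savart kernel `K(x) = x^⊥ / (2π|x|²)`, with `(x₁, x₂)^⊥ = (-x₂, x₁)`. -/
def biotSavartKernel (x : Plane) : Plane :=
  (2 * Real.pi * ‖x‖ ^ 2)⁻¹ • !₂[-(x 1), x 0]

/-- Absolute convergence, at every point of the plane, of the integral defining `K * ω`. -/
def VelocityExists (ω : Plane → ℝ) : Prop :=
  ConvolutionExists ω biotSavartKernel (ContinuousLinearMap.lsmul ℝ ℝ) volume

/-- The velocity `u = K * ω`, that is `u(x) = ∫ ω(y) K(x - y) dy`. -/
def velocity (ω : Plane → ℝ) : Plane → Plane :=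
  convolution ω biotSavartKernel (ContinuousLinearMap.lsmul ℝ ℝ) volume

theorem velocity_apply (ω : Plane → ℝ) (x : Plane) :
    velocity ω x = ∫ y, ω y • biotSavartKernel (x - y) := rfl

/-! ### Zygmund spaces `L^p (log L)^a` on the plane -/

/-- The function `A_{p,a}(s) = [s log^a (2 + s)]^p`, used for `s ≥ 0`. -/
def zygmundA (p a s : ℝ) : ℝ :=
  (s * Real.log (2 + s) ^ a) ^ p

/-- Membership in the Zygmund space `L^p (log L)^a`. -/
def MemZygmund (p a : ℝ) (f : Plane → ℝ) : Prop :=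
  LocallyIntegrable f volume ∧ ∫⁻ x, ENNReal.ofReal (zygmundA p a |f x|) < ∞

/-- The Luxemburg norm `inf {k > 0 | ∫ A_{p,a}(|f| / k) ≤ 1}`, with value `∞` if there is no
such `k`. -/
def luxemburgNorm (p a : ℝ) (f : Plane → ℝ) : ℝ≥0∞ :=
  ⨅ (k : ℝ≥0) (_ : 0 < k ∧ ∫⁻ x, ENNReal.ofReal (zygmundA p a (|f x| / k)) ≤ 1), (k : ℝ≥0∞)

/-! ### The vorticities -/

/-- The upper half disk `B⁺(0; r)`. -/
def upperHalfDisk (r : ℝ) : Set Plane :=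
  {x | ‖x‖ < r ∧ 0 < x 1}

/-- The vorticity `ω^α_+ (x) = |x|⁻¹ |log |x||^{-α}` on `B⁺(0; 1/3)`, zero elsewhere. -/
def omegaPlus (α : ℝ) : Plane → ℝ :=
  (upperHalfDisk (1 / 3)).indicator fun x => 1 / (‖x‖ * |Real.log ‖x‖| ^ α)

open Classical in
/-- The truncated vorticity `ω^n_+`: in the closed upper half plane it is `ω^α_+` for `|x| > 1/n`
and the constant `n / |log n|^α` for `|x| ≤ 1/n`; it is zero in the lower half plane. -/
def omegaTrunc (α : ℝ) (n : ℕ) (x : Plane) : ℝ :=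
  if x 1 < 0 then 0
  else if 1 / (n : ℝ) < ‖x‖ then omegaPlus α x
  else (n : ℝ) / |Real.log n| ^ α

/-! ### The nonlinear map `ω ↦ u |ω|²` and its continuous extensions -/

/-- The vector field `u |ω|²`, with `u = K * ω`. -/
def transportTerm (ω : Plane → ℝ) (x : Plane) : Plane :=
  |ω x| ^ 2 • velocity ω x

/-- `T` is a continuous extension of `ω ↦ u |ω|² ∈ 𝓓'(ℝ²; ℝ²)` from `L^p_c` to `X_c`, where `X` is
the space of functions with `Mem f`, with norm `N`, and `X_c` is the set of its elements with
compact support. Continuity is sequential, along sequences that converge in the norm `N` with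
supports in a common compact set, and for the convergence of distributions tested on each test
function: it is implied by continuity for any of the usual topologies on `X_c` (the norm topology,
the inductive limit topology) and on `𝓓'` (the weak one, the strong one). -/
def IsContinuousExtension (p : ℝ≥0∞) (Mem : (Plane → ℝ) → Prop) (N : (Plane → ℝ) → ℝ≥0∞)
    (T : (Plane → ℝ) → 𝓓'((⊤ : TopologicalSpace.Opens Plane), Plane)) : Prop :=
  (∀ ω : Plane → ℝ, Mem ω → HasCompactSupport ω → MemLp ω p volume →
    ∀ φ : 𝓓((⊤ : TopologicalSpace.Opens Plane), ℝ), T ω φ = ∫ x, φ x • transportTerm ω x) ∧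
  (∀ (w : ℕ → Plane → ℝ) (ω : Plane → ℝ) (C : Set Plane), IsCompact C →
    (∀ n, Mem (w n) ∧ tsupport (w n) ⊆ C) → Mem ω → tsupport ω ⊆ C →
    Tendsto (fun n => N (w n - ω)) atTop (𝓝 0) →
    ∀ φ : 𝓓((⊤ : TopologicalSpace.Opens Plane), ℝ),
      Tendsto (fun n => T (w n) φ) atTop (𝓝 (T ω φ)))

end

/-! The vorticity is nonnegative and lives in the upper half plane, so all of it pushes the fluid at
the origin in the same horizontal direction. Up to a bounded error, `u₁(x)` is at least the integral
of `w(y) y₂ / (2π|y|²)` over `|y| > 2|x|` (`farField_sub_le`, `exists_farField_le_velocity`). In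
polar coordinates this grows like `|log |x||^(1-α)` for `|x| > 1/n` (`le_integral_farField`).

Multiplying by `|x|⁻² |log |x||^(-2α)` gives the density `|x|⁻² |log |x||^(1-3α)`. For `α ≤ 2/3` it
dominates `|x|⁻² |log |x||⁻¹`, whose integral over `|x| > 1/n` diverges like `log log n`. The
bounded error costs only a multiple of `∫ |ω|²`, finite because `α > 1/2`
(`tendsto_integral_velocity_mul_sq`).

The truncations nevertheless converge: `A_{2,κ}(ω/k)` is dominated by a multiple of `|x|⁻² |log
|x||^(-2(α-κ))`, integrable when `κ < α - 1/2` (`tendsto_lintegral_zygmundA_sub`). A continuous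
extension, tested against a cutoff equal to 1 on all the supports, would make a divergent sequence
converge; `α = 2/3` covers every `κ < 1/6`. -/

/-! ### The kernel, and the velocity of compactly supported `L^p` vorticities, `p > 2` -/

theorem Plane.norm_sq (x : Plane) : ‖x‖ ^ 2 = x 0 ^ 2 + x 1 ^ 2 := by
  rw [EuclideanSpace.real_norm_sq_eq, Fin.sum_univ_two]

theorem Plane.abs_apply_le (x : Plane) (i : Fin 2) : |x i| ≤ ‖x‖ := PiLp.norm_apply_le x i

theorem norm_biotSavartKernel (x : Plane) : ‖biotSavartKernel x‖ = (2 * Real.pi * ‖x‖)⁻¹ := by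
  have h : ‖(!₂[-(x 1), x 0] : Plane)‖ = ‖x‖ := by
    rw [← sq_eq_sq₀ (norm_nonneg _) (norm_nonneg _), Plane.norm_sq, Plane.norm_sq]
    simp
    ring
  rw [biotSavartKernel, norm_smul, h, Real.norm_of_nonneg (by positivity)]
  rcases eq_or_ne ‖x‖ 0 with h0 | h0
  · simp [h0]
  · field_simp

theorem biotSavartKernel_zero_apply (x : Plane) :
    biotSavartKernel x 0 = -(x 1) / (2 * Real.pi * ‖x‖ ^ 2) := by
  simp [biotSavartKernel, div_eq_inv_mul]

theorem measurable_biotSavartKernel : Measurable biotSavartKernel := by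
  unfold biotSavartKernel
  exact ((measurable_norm.pow_const 2).const_mul _).inv.smul (Continuous.measurable (by fun_prop))

/-- A radial function on the plane is integrable iff its profile is integrable for `r dr`. -/
theorem Plane.integrable_fun_norm {f : ℝ → ℝ} :
    Integrable (fun x : Plane => f ‖x‖) ↔
      IntegrableOn (fun r => r * f r) (Set.Ioi 0) := by
  have := integrable_fun_norm_addHaar (volume : Measure Plane) (f := f)
  simpa using this

theorem integrable_truncated_rpow {s : ℝ} (hs : s < 2) (R : ℝ) :
    Integrable (fun x : Plane => (Set.Ioo 0 R).indicator (fun r => r ^ (-s)) ‖x‖) := by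
  rw [Plane.integrable_fun_norm]
  have h1 : IntegrableOn (fun r : ℝ => r ^ (1 - s)) (Set.Ioo 0 R) := by
    rcases le_or_gt R 0 with h | h
    · simp [Set.Ioo_eq_empty_of_le h]
    · exact (intervalIntegral.integrableOn_Ioo_rpow_iff h).2 (by linarith)
  have h2 : Integrable ((Set.Ioo 0 R).indicator (fun r : ℝ => r ^ (1 - s))) :=
    (integrable_indicator_iff measurableSet_Ioo).2 h1
  refine h2.integrableOn.congr_fun (fun r hr => ?_) measurableSet_Ioi
  have hr' : 0 < r := hr
  by_cases h : r ∈ Set.Ioo 0 R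
  · simp only [Set.indicator_of_mem h]
    rw [sub_eq_add_neg, Real.rpow_add hr', Real.rpow_one]
  · simp [Set.indicator_of_notMem h]

/-- Young's inequality below needs a finite exponent, while `p` may be `∞`; compact support allows
lowering it to `min p 3`, still above 2. -/
theorem exists_integrable_bound {ω : Plane → ℝ} {p : ℝ≥0∞} (hp : 2 < p) (hω : MemLp ω p volume)
    (hc : HasCompactSupport ω) : ∃ r : ℝ, 2 < r ∧ Integrable (fun x => |ω x| ^ r) := by
  have hfin : (min p 3) ≠ ∞ := ne_of_lt (lt_of_le_of_lt (min_le_right _ _) (by simp))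
  have h2 : 2 < min p 3 := lt_min hp (by norm_num)
  have h : MemLp ω (min p 3) volume :=
     hω.mono_exponent_of_measure_support_ne_top
      (fun x hx => image_eq_zero_of_notMem_tsupport hx) hc.isCompact.measure_lt_top.ne
      (min_le_left _ _)
  refine ⟨(min p 3).toReal, ?_, ?_⟩
  · have := (ENNReal.toReal_lt_toReal (by simp) hfin).2 h2
    simpa using this
  · simpa using h.integrable_norm_rpow (by positivity) hfin

/-- Local boundedness of the velocity field of a compactly supported vorticity in `L^p`, `p > 2`. -/
theorem exists_velocity_bound {ω : Plane → ℝ} {p : ℝ≥0∞} (hp : 2 < p) (hω : MemLp ω p volume)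
    (hc : HasCompactSupport ω) (ρ : ℝ) : ∃ M : ℝ, ∀ x : Plane, ‖x‖ < ρ →
      Integrable (fun y => ω y • biotSavartKernel (x - y)) ∧ ‖velocity ω x‖ ≤ M := by
  obtain ⟨r, hr, hint⟩ := exists_integrable_bound hp hω hc
  obtain ⟨R, hR⟩ := hc.isBounded.exists_norm_le
  -- The conjugate exponent: `r > 2` means `s < 2`, so `|z|^(-s)` is locally integrable in the
  -- plane. Young's inequality then bounds the integrand by `|ω|^r + k(x - y)`, whose integral does
  -- not depend on `x`.
  set s : ℝ := r / (r - 1) with hs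
  have hs2 : s < 2 := by rw [hs, div_lt_iff₀ (by linarith)]; linarith
  have hs0 : 0 < s := by rw [hs]; exact div_pos (by linarith) (by linarith)
  have hrs : r.HolderConjugate s := Real.HolderConjugate.conjExponent (by linarith)
  set k : Plane → ℝ := fun z => (Set.Ioo 0 (ρ + R + 1)).indicator (fun t => t ^ (-s)) ‖z‖ with hk
  have hkint : Integrable k := integrable_truncated_rpow hs2 _
  have hbound : ∀ x : Plane, ‖x‖ < ρ → ∀ y, ‖ω y • biotSavartKernel (x - y)‖ ≤
      |ω y| ^ r + k (x - y) := by
    intro x hx y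
    have hk0 : ∀ z, 0 ≤ k z := fun z =>
      Set.indicator_nonneg (fun t ht => Real.rpow_nonneg ht.1.le _) _
    have hpos : 0 ≤ |ω y| ^ r + k (x - y) := add_nonneg (by positivity) (hk0 _)
    rcases eq_or_ne (ω y) 0 with h0 | h0
    · simpa [h0] using hpos
    rcases eq_or_ne (x - y) 0 with h1 | h1
    · simpa [h1, norm_smul, norm_biotSavartKernel] using hpos
    have hy : ‖y‖ ≤ R := hR y (subset_tsupport ω h0)
    have hz : 0 < ‖x - y‖ := norm_pos_iff.2 h1
    have hmem : ‖x - y‖ ∈ Set.Ioo 0 (ρ + R + 1) := ⟨hz, by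
      have := norm_sub_le x y
      linarith⟩
    have hkz : k (x - y) = (‖x - y‖⁻¹) ^ s := by
      simp only [hk, Set.indicator_of_mem hmem]
      rw [Real.rpow_neg hz.le, Real.inv_rpow hz.le]
    rw [norm_smul, norm_biotSavartKernel, Real.norm_eq_abs, hkz]
    have hy1 := Real.young_inequality_of_nonneg (abs_nonneg (ω y)) (inv_nonneg.2 hz.le) hrs
    have hA : |ω y| ^ r / r ≤ |ω y| ^ r := div_le_self (by positivity) (by linarith)
    have hB : (‖x - y‖⁻¹) ^ s / s ≤ (‖x - y‖⁻¹) ^ s :=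
      div_le_self (by positivity) hrs.symm.lt.le
    have hC : (2 * Real.pi * ‖x - y‖)⁻¹ ≤ ‖x - y‖⁻¹ := by
      gcongr
      nlinarith [Real.pi_gt_three]
    have hD := mul_le_mul_of_nonneg_left hC (abs_nonneg (ω y))
    linarith
  have hbint : ∀ x, Integrable (fun y => |ω y| ^ r + k (x - y)) :=
    fun x => hint.add (hkint.comp_sub_left x)
  refine ⟨(∫ y, |ω y| ^ r) + ∫ z, k z, fun x hx => ⟨?_, ?_⟩⟩
  · refine (hbint x).mono' ?_ (Eventually.of_forall (hbound x hx))
    exact hω.1.smul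
      (measurable_biotSavartKernel.comp (measurable_const.sub measurable_id)).aestronglyMeasurable
  · rw [velocity_apply]
    refine (norm_integral_le_of_norm_le (hbint x) (Eventually.of_forall (hbound x hx))).trans ?_
    rw [integral_add hint (hkint.comp_sub_left x), integral_sub_left_eq_self]

theorem velocityExists_of_memLp {ω : Plane → ℝ} {p : ℝ≥0∞} (hp : 2 < p) (hω : MemLp ω p volume)
    (hc : HasCompactSupport ω) : VelocityExists ω := by
  intro x
  obtain ⟨M, hM⟩ := exists_velocity_bound hp hω hc (‖x‖ + 1)
  exact (hM x (by linarith)).1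

theorem aestronglyMeasurable_velocity {ω : Plane → ℝ} (hω : AEStronglyMeasurable ω volume) :
    AEStronglyMeasurable (velocity ω) volume := by
  have h := AEStronglyMeasurable.convolution_integrand (μ := (volume : Measure Plane))
    (ν := (volume : Measure Plane)) (ContinuousLinearMap.lsmul ℝ ℝ) hω
    measurable_biotSavartKernel.aestronglyMeasurable
  exact h.integral_prod_right'

theorem integrable_transportTerm {ω : Plane → ℝ} {p : ℝ≥0∞} (hp : 2 < p) (hω : MemLp ω p volume)
    (hc : HasCompactSupport ω) : Integrable (transportTerm ω) volume := by
  obtain ⟨R, hR⟩ := hc.isBounded.exists_norm_le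
  obtain ⟨r, hr, hint⟩ := exists_integrable_bound hp hω hc
  obtain ⟨M, hM⟩ := exists_velocity_bound hp hω hc (R + 1)
  -- On the support, `|ω|² ≤ |ω|^r + 1`; the constant is cut off to stay integrable.
  have hi : Integrable ((tsupport ω).indicator (fun _ => (1 : ℝ))) :=
    (integrable_indicator_iff (isClosed_tsupport ω).measurableSet).2
      (integrableOn_const hc.isCompact.measure_lt_top.ne)
  refine ((hint.add hi).mul_const M).mono' ?_ (Eventually.of_forall fun x => ?_)
  · exact AEStronglyMeasurable.smul (by simpa using (hω.1.norm.pow 2))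
      (aestronglyMeasurable_velocity hω.1)
  rcases eq_or_ne (ω x) 0 with h0 | h0
  · by_cases hx : x ∈ tsupport ω
    · have hM' := (norm_nonneg _).trans (hM x (by linarith [hR x hx])).2
      simp only [transportTerm, h0, Pi.add_apply]
      simp [Set.indicator_of_mem hx]
      positivity
    · simp [transportTerm, h0, Set.indicator_of_notMem hx, Real.zero_rpow (by linarith : r ≠ 0)]
  have hx : x ∈ tsupport ω := subset_tsupport ω h0
  have hM' := (hM x (by linarith [hR x hx])).2
  rw [transportTerm, norm_smul, Pi.add_apply, Set.indicator_of_mem hx]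
  refine mul_le_mul ?_ hM' (norm_nonneg _) (by positivity)
  rw [Real.norm_of_nonneg (by positivity)]
  rcases le_total |ω x| 1 with h | h
  · have : |ω x| ^ 2 ≤ 1 := pow_le_one₀ (abs_nonneg _) h
    have : 0 ≤ |ω x| ^ r := by positivity
    linarith
  · have : |ω x| ^ (2 : ℝ) ≤ |ω x| ^ r := Real.rpow_le_rpow_of_exponent_le h hr.le
    rw [Real.rpow_two] at this
    linarith

/-! ### Polar coordinates in the upper half plane -/

theorem lintegral_sin_Ioo_zero_pi :
    ∫⁻ θ in Set.Ioo 0 Real.pi, ENNReal.ofReal (Real.sin θ) = 2 := by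
  rw [← ofReal_integral_eq_lintegral_ofReal]
  · rw [← integral_Ioc_eq_integral_Ioo, ← intervalIntegral.integral_of_le Real.pi_pos.le,
      integral_sin]
    norm_num
  · exact (Real.continuous_sin.integrableOn_Icc (a := 0) (b := Real.pi)).mono_set
      Set.Ioo_subset_Icc_self
  · exact (ae_restrict_iff' measurableSet_Ioo).2 (Eventually.of_forall fun θ hθ =>
      (Real.sin_pos_of_mem_Ioo hθ).le)

theorem Plane.lintegral_eq_prod {F : Plane → ℝ≥0∞} (hF : Measurable F) :
    ∫⁻ x, F x = ∫⁻ p : ℝ × ℝ, F !₂[p.1, p.2] := by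
  have h := (PiLp.volume_preserving_toLp (Fin 2)).comp
    (volume_preserving_finTwoArrow ℝ).symm
  rw [← h.lintegral_comp hF]
  rfl

/-- Polar coordinates in the upper half plane, for `sin θ` times a radial function. -/
theorem Plane.two_mul_lintegral_le {g : ℝ → ℝ≥0∞} (hg : Measurable g) :
    2 * ∫⁻ r in Set.Ioi 0, ENNReal.ofReal r * g r ≤
      ∫⁻ x in {x : Plane | 0 < x 1}, ENNReal.ofReal (x 1 / ‖x‖) * g ‖x‖ := by
  have hS : MeasurableSet {x : Plane | 0 < x 1} :=
    measurableSet_lt measurable_const (by fun_prop)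
  have hm : Measurable fun x : Plane => ENNReal.ofReal (x 1 / ‖x‖) * g ‖x‖ := by
    have : Measurable fun x : Plane => x 1 := by fun_prop
    exact (ENNReal.measurable_ofReal.comp (this.div measurable_norm)).mul
      (hg.comp measurable_norm)
  rw [← lintegral_indicator hS, Plane.lintegral_eq_prod (hm.indicator hS),
    ← lintegral_comp_polarCoord_symm]
  -- Only an inequality is needed, so the other angles are dropped instead of being shown to
  -- contribute zero.
  have hsub : Set.Ioi (0 : ℝ) ×ˢ Set.Ioo 0 Real.pi ⊆ polarCoord.target := by
    rintro ⟨r, θ⟩ ⟨hr, hθ⟩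
    exact ⟨hr, ⟨by linarith [hθ.1, Real.pi_pos], hθ.2⟩⟩
  refine le_trans (le_of_eq ?_) (lintegral_mono_set hsub)
  have h1 : ∀ p ∈ Set.Ioi (0 : ℝ) ×ˢ Set.Ioo 0 Real.pi,
      ENNReal.ofReal p.1 • ({x : Plane | 0 < x 1}.indicator
        (fun x : Plane => ENNReal.ofReal (x 1 / ‖x‖) * g ‖x‖)
        !₂[(polarCoord.symm p).1, (polarCoord.symm p).2]) =
      (ENNReal.ofReal p.1 * g p.1) * ENNReal.ofReal (Real.sin p.2) := by
    rintro ⟨r, θ⟩ ⟨hr, hθ⟩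
    have hr' : 0 < r := hr
    have hs : 0 < Real.sin θ := Real.sin_pos_of_mem_Ioo hθ
    have hn : ‖(!₂[r * Real.cos θ, r * Real.sin θ] : Plane)‖ = r := by
      rw [← sq_eq_sq₀ (norm_nonneg _) hr'.le, Plane.norm_sq]
      simp
      nlinarith [Real.sin_sq_add_cos_sq θ]
    simp only [polarCoord_symm_apply]
    rw [Set.indicator_of_mem (by simp; positivity), hn]
    simp only [smul_eq_mul]
    have : (!₂[r * Real.cos θ, r * Real.sin θ] : Plane) 1 / r = Real.sin θ := by
      simp; field_simp
    rw [this]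
    ring
  rw [setLIntegral_congr_fun (measurableSet_Ioi.prod measurableSet_Ioo) h1,
    Measure.volume_eq_prod, ← Measure.prod_restrict,
    lintegral_prod_mul (f := fun r => ENNReal.ofReal r * g r)
      (g := fun θ => ENNReal.ofReal (Real.sin θ))
      ((ENNReal.measurable_ofReal.mul hg).aemeasurable)
      ((ENNReal.measurable_ofReal.comp Real.measurable_sin).aemeasurable),
    lintegral_sin_Ioo_zero_pi, mul_comm]

/-! ### Pointwise properties of the vorticities -/

/-- The cutoff `1/3` lies below `1/e`, so powers of `|log r|` are monotone in the exponent. -/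
theorem one_lt_neg_log {r : ℝ} (h0 : 0 < r) (h : r ≤ 1 / 3) : 1 < -Real.log r := by
  rw [← Real.log_inv, Real.lt_log_iff_exp_lt (by positivity)]
  have h3 : (3 : ℝ) ≤ r⁻¹ := by
    rw [le_inv_comm₀ (by norm_num) h0]; linarith
  linarith [Real.exp_one_lt_d9]

theorem abs_log_eq {r : ℝ} (h0 : 0 < r) (h : r ≤ 1 / 3) : |Real.log r| = -Real.log r :=
  abs_of_neg (by linarith [one_lt_neg_log h0 h])

theorem one_lt_abs_log {r : ℝ} (h0 : 0 < r) (h : r ≤ 1 / 3) : 1 < |Real.log r| := by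
  rw [abs_log_eq h0 h]; exact one_lt_neg_log h0 h

/-- `r ↦ r |log r| ^ α` is monotone on `(0, 1/3]` for `α ≤ 1`. -/
theorem mul_abs_log_rpow_mono {α : ℝ} (h1 : α ≤ 1) {r t : ℝ} (hr : 0 < r)
    (hrt : r ≤ t) (ht : t ≤ 1 / 3) :
    r * |Real.log r| ^ α ≤ t * |Real.log t| ^ α := by
  have ht0 : 0 < t := hr.trans_le hrt
  rw [abs_log_eq hr (hrt.trans ht), abs_log_eq ht0 ht]
  have hb := one_lt_neg_log ht0 ht
  have hab : -Real.log t ≤ -Real.log r := neg_le_neg (Real.log_le_log hr hrt)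
  set a := -Real.log r with ha
  set b := -Real.log t with hbd
  have hra : r = Real.exp (-a) := by rw [ha, neg_neg, Real.exp_log hr]
  have htb : t = Real.exp (-b) := by rw [hbd, neg_neg, Real.exp_log ht0]
  have hb0 : 0 < b := by linarith
  have ha0 : 0 < a := by linarith
  -- With `r = e^(-a)`, `t = e^(-b)` this is the claim; it holds since `a/b ≤ 1 + (a - b)` for `b ≥
  -- 1`.
  have h2 : a ^ α / b ^ α ≤ Real.exp (a - b) := by
    rw [← Real.div_rpow ha0.le hb0.le]
    have h3 : (a / b) ^ α ≤ (a / b) ^ (1 : ℝ) :=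
      Real.rpow_le_rpow_of_exponent_le ((one_le_div hb0).2 hab) h1
    rw [Real.rpow_one] at h3
    have h4 : a / b ≤ 1 + (a - b) := by
      rw [div_le_iff₀ hb0]; nlinarith
    linarith [Real.add_one_le_exp (a - b)]
  rw [div_le_iff₀ (by positivity)] at h2
  rw [hra, htb]
  calc Real.exp (-a) * a ^ α ≤ Real.exp (-a) * (Real.exp (a - b) * b ^ α) := by gcongr
    _ = Real.exp (-b) * b ^ α := by rw [← mul_assoc, ← Real.exp_add]; ring_nf

theorem Plane.measurable_apply_one : Measurable fun x : Plane => x 1 := by fun_prop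

theorem measurableSet_upperHalfDisk (r : ℝ) : MeasurableSet (upperHalfDisk r) :=
  (measurableSet_lt measurable_norm measurable_const).inter
    (measurableSet_lt measurable_const Plane.measurable_apply_one)

theorem measurable_omegaPlus (α : ℝ) : Measurable (omegaPlus α) := by
  refine Measurable.indicator ?_ (measurableSet_upperHalfDisk _)
  exact measurable_const.div (measurable_norm.mul
    ((continuous_abs.measurable.comp (Real.measurable_log.comp measurable_norm)).pow_const α))

theorem norm_pos_of_mem_upperHalfDisk {r : ℝ} {x : Plane} (h : x ∈ upperHalfDisk r) :
    0 < ‖x‖ :=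
  h.2.trans_le ((le_abs_self _).trans (Plane.abs_apply_le x 1))

theorem omegaPlus_of_mem (α : ℝ) {x : Plane} (h : x ∈ upperHalfDisk (1 / 3)) :
    omegaPlus α x = 1 / (‖x‖ * |Real.log ‖x‖| ^ α) :=
  Set.indicator_of_mem h _

theorem omegaPlus_of_notMem (α : ℝ) {x : Plane} (h : x ∉ upperHalfDisk (1 / 3)) :
    omegaPlus α x = 0 :=
  Set.indicator_of_notMem h _

theorem omegaPlus_nonneg (α : ℝ) (x : Plane) : 0 ≤ omegaPlus α x :=
  Set.indicator_nonneg (fun _ _ => by positivity) _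

theorem omegaPlus_mul_norm_le {α : ℝ} (hα : 0 ≤ α) (x : Plane) : omegaPlus α x * ‖x‖ ≤ 1 := by
  by_cases h : x ∈ upperHalfDisk (1 / 3)
  · have h0 := norm_pos_of_mem_upperHalfDisk h
    have h1 := one_lt_abs_log h0 h.1.le
    have h2 := Real.one_le_rpow h1.le hα
    rw [omegaPlus_of_mem α h, div_mul_eq_mul_div, one_mul, div_le_one (by positivity)]
    exact le_mul_of_one_le_right h0.le h2
  · simp [omegaPlus_of_notMem α h]

theorem omegaTrunc_of_neg (α : ℝ) (n : ℕ) {x : Plane} (h : x 1 < 0) : omegaTrunc α n x = 0 := by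
  simp [omegaTrunc, h]

theorem omegaTrunc_of_lt_norm (α : ℝ) {n : ℕ} {x : Plane} (h : 1 / (n : ℝ) < ‖x‖) :
    omegaTrunc α n x = omegaPlus α x := by
  unfold omegaTrunc
  split_ifs with h1
  · exact (omegaPlus_of_notMem α fun h2 => lt_asymm h1 h2.2).symm
  · rfl

theorem omegaTrunc_of_norm_le (α : ℝ) {n : ℕ} {x : Plane} (h0 : 0 ≤ x 1)
    (h : ‖x‖ ≤ 1 / (n : ℝ)) : omegaTrunc α n x = (n : ℝ) / |Real.log n| ^ α := by
  unfold omegaTrunc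
  rw [if_neg h0.not_gt, if_neg h.not_gt]

theorem measurable_omegaTrunc (α : ℝ) (n : ℕ) : Measurable (omegaTrunc α n) := by
  unfold omegaTrunc
  refine Measurable.ite (measurableSet_lt (by fun_prop) measurable_const) measurable_const ?_
  exact Measurable.ite (measurableSet_lt measurable_const measurable_norm)
    (measurable_omegaPlus α) measurable_const

theorem omegaTrunc_nonneg (α : ℝ) (n : ℕ) (x : Plane) : 0 ≤ omegaTrunc α n x := by
  unfold omegaTrunc
  split_ifs
  · exact le_rfl
  · exact omegaPlus_nonneg α x
  · positivity

/-- `3 ≤ n` gives `log n > 1`. At `n = 2` and `α > 0` the plateau exceeds `n` and the bound fails.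
-/
theorem omegaTrunc_mul_norm_le {α : ℝ} (hα : 0 ≤ α) {n : ℕ} (hn : 3 ≤ n) (x : Plane) :
    omegaTrunc α n x * ‖x‖ ≤ 1 := by
  rcases lt_or_ge (1 / (n : ℝ)) ‖x‖ with h | h
  · rw [omegaTrunc_of_lt_norm α h]; exact omegaPlus_mul_norm_le hα x
  rcases lt_or_ge (x 1) 0 with h0 | h0
  · simp [omegaTrunc_of_neg α n h0]
  have hn' : (3 : ℝ) ≤ n := by exact_mod_cast hn
  rw [omegaTrunc_of_norm_le α h0 h]
  have h1 : 1 < |Real.log n| := by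
    have := one_lt_abs_log (r := 1 / (n : ℝ)) (by positivity)
      (one_div_le_one_div_of_le (by norm_num) hn')
    rwa [one_div, Real.log_inv, abs_neg] at this
  have h2 := Real.one_le_rpow h1.le hα
  calc (n : ℝ) / |Real.log n| ^ α * ‖x‖ ≤ n * (1 / n) := by
        gcongr
        exact div_le_self (by positivity) h2
    _ = 1 := by field_simp

/-- Monotonicity of `r |log r|^α` puts the plateau below the singular profile. `4 ≤ n` keeps `1/n`
inside the disk of radius `1/3`; on the axis the truncation is positive near 0 while `omegaPlus`
vanishes. -/
theorem omegaTrunc_le_omegaPlus {α : ℝ} (hα1 : α ≤ 1) {n : ℕ} (hn : 4 ≤ n)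
    {x : Plane} (hx : x 1 ≠ 0) : omegaTrunc α n x ≤ omegaPlus α x := by
  rcases lt_or_ge (1 / (n : ℝ)) ‖x‖ with h | h
  · rw [omegaTrunc_of_lt_norm α h]
  rcases lt_or_gt_of_ne hx with h0 | h0
  · rw [omegaTrunc_of_neg α n h0]; exact omegaPlus_nonneg α x
  have hn' : (4 : ℝ) ≤ n := by exact_mod_cast hn
  have h4 : 1 / (n : ℝ) < 1 / 3 := one_div_lt_one_div_of_lt (by norm_num) (by linarith)
  have hmem : x ∈ upperHalfDisk (1 / 3) := ⟨h.trans_lt h4, h0⟩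
  have hpos := norm_pos_of_mem_upperHalfDisk hmem
  have hlog := one_lt_abs_log hpos hmem.1.le
  rw [omegaTrunc_of_norm_le α h0.le h, omegaPlus_of_mem α hmem]
  have hmono := mul_abs_log_rpow_mono hα1 hpos h h4.le
  have : (n : ℝ) / |Real.log n| ^ α = 1 / (1 / (n : ℝ) * |Real.log (1 / (n : ℝ))| ^ α) := by
    rw [one_div (n : ℝ), Real.log_inv, abs_neg, one_div, mul_inv, inv_inv, div_eq_mul_inv]
  rw [this]
  exact one_div_le_one_div_of_le (by positivity) hmono

theorem omegaTrunc_le {α : ℝ} (hα : 0 ≤ α) {n : ℕ} (hn : 2 ≤ n) (x : Plane) :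
    omegaTrunc α n x ≤ max (n : ℝ) (n / |Real.log n| ^ α) := by
  have hn0 : (0 : ℝ) < n := by exact_mod_cast (by omega : 0 < n)
  rcases lt_or_ge (1 / (n : ℝ)) ‖x‖ with h | h
  · rw [omegaTrunc_of_lt_norm α h]
    refine le_max_of_le_left ?_
    have h1 := omegaPlus_mul_norm_le hα x
    have h2 := mul_le_mul_of_nonneg_left h.le (omegaPlus_nonneg α x)
    have h3 := h2.trans h1
    rwa [mul_one_div, div_le_one hn0] at h3
  · rcases lt_or_ge (x 1) 0 with h0 | h0
    · rw [omegaTrunc_of_neg α n h0]; positivity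
    · rw [omegaTrunc_of_norm_le α h0 h]; exact le_max_right _ _

/-- The common radius is `1/2`, not `1/3`, because the plateau for `n = 2` reaches `|x| = 1/2`. -/
theorem omegaPlus_of_half_lt (α : ℝ) {x : Plane} (hx : 1 / 2 < ‖x‖) : omegaPlus α x = 0 :=
  omegaPlus_of_notMem α fun h => by linarith [h.1]

theorem omegaTrunc_of_half_lt (α : ℝ) {n : ℕ} (hn : 2 ≤ n) {x : Plane} (hx : 1 / 2 < ‖x‖) :
    omegaTrunc α n x = 0 := by
  have hn' : (2 : ℝ) ≤ n := by exact_mod_cast hn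
  rw [omegaTrunc_of_lt_norm α ((one_div_le_one_div_of_le (by norm_num) hn').trans_lt hx),
    omegaPlus_of_half_lt α hx]

theorem tsupport_subset_closedBall {f : Plane → ℝ} {r : ℝ} (h : ∀ x, r < ‖x‖ → f x = 0) :
    tsupport f ⊆ Metric.closedBall 0 r := by
  refine closure_minimal (fun x hx => ?_) Metric.isClosed_closedBall
  rw [mem_closedBall_zero_iff]
  exact not_lt.1 fun h' => hx (h x h')

theorem tsupport_omegaPlus (α : ℝ) : tsupport (omegaPlus α) ⊆ Metric.closedBall 0 (1 / 2) :=
  tsupport_subset_closedBall fun _ => omegaPlus_of_half_lt α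

theorem tsupport_omegaTrunc (α : ℝ) {n : ℕ} (hn : 2 ≤ n) :
    tsupport (omegaTrunc α n) ⊆ Metric.closedBall 0 (1 / 2) :=
  tsupport_subset_closedBall fun _ => omegaTrunc_of_half_lt α hn

theorem hasCompactSupport_omegaTrunc (α : ℝ) {n : ℕ} (hn : 2 ≤ n) :
    HasCompactSupport (omegaTrunc α n) :=
  (isCompact_closedBall _ _).of_isClosed_subset (isClosed_tsupport _) (tsupport_omegaTrunc α hn)

theorem memLp_omegaTrunc {α : ℝ} (hα : 0 ≤ α) {n : ℕ} (hn : 2 ≤ n) (p : ℝ≥0∞) :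
    MemLp (omegaTrunc α n) p volume := by
  have h : MemLp (omegaTrunc α n) ∞ volume :=
    memLp_top_of_bound (measurable_omegaTrunc α n).aestronglyMeasurable
      (max (n : ℝ) (n / |Real.log n| ^ α)) (Eventually.of_forall fun x => by
        rw [Real.norm_of_nonneg (omegaTrunc_nonneg α n x)]
        exact omegaTrunc_le hα hn x)
  exact h.mono_exponent_of_measure_support_ne_top
    (fun x hx => omegaTrunc_of_half_lt α hn (by simpa using hx))
    (isCompact_closedBall (0 : Plane) (1 / 2)).measure_lt_top.ne le_top

/-! ### Zygmund membership and norm convergence -/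

theorem integrableOn_inv_mul_neg_log_rpow {β : ℝ} (hβ : 1 < β) :
    IntegrableOn (fun r : ℝ => (r * (-Real.log r) ^ β)⁻¹) (Set.Ioc 0 (1 / 3)) := by
  have hβ' : 0 < β - 1 := by linarith
  refine intervalIntegral.integrableOn_deriv_of_nonneg
    (g := fun r => (-Real.log r) ^ (-(β - 1)) / (β - 1)) ?_ ?_ ?_
  · intro r hr
    rcases hr.1.eq_or_lt with h0 | h0
    · subst h0
      refine ContinuousWithinAt.mono ?_ Set.Icc_subset_Ici_self
      rw [← continuousWithinAt_Ioi_iff_Ici, ContinuousWithinAt]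
      have h := ((tendsto_rpow_neg_atTop hβ').comp
        (tendsto_neg_atBot_atTop.comp Real.tendsto_log_nhdsGT_zero)).div_const (β - 1)
      -- The default values `log 0 = 0` and `0 ^ (-(β - 1)) = 0` agree with the limit, so the
      -- antiderivative is continuous up to 0.
      have h0 : (-Real.log 0) ^ (-(β - 1)) / (β - 1) = 0 / (β - 1) := by
        rw [Real.log_zero, neg_zero, Real.zero_rpow (by linarith)]
      rw [h0]
      exact h
    · have := one_lt_neg_log h0 hr.2
      refine ContinuousAt.continuousWithinAt ?_
      exact ((Real.continuousAt_log h0.ne').neg.rpow_const (Or.inl (by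
        simp only [Pi.neg_apply]; linarith))).div_const _
  · intro r hr
    have := one_lt_neg_log hr.1 hr.2.le
    have h := (((Real.hasDerivAt_log hr.1.ne').neg.rpow_const (p := -(β - 1))
      (Or.inl (by simp only [Pi.neg_apply]; linarith))).div_const (β - 1))
    have h2 : (-Real.log r) ^ (-(β - 1) - 1) = ((-Real.log r) ^ β)⁻¹ := by
      rw [← Real.rpow_neg (by linarith)]; ring_nf
    have h3 : (r * (-Real.log r) ^ β)⁻¹ =
        -r⁻¹ * -(β - 1) * (-Real.log) r ^ (-(β - 1) - 1) / (β - 1) := by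
      rw [Pi.neg_apply, h2, mul_inv]
      field_simp
    rw [h3]
    exact h
  · intro r hr
    have := one_lt_neg_log hr.1 hr.2.le
    have h0 := hr.1
    positivity

/-- A radial majorant of `A_{2,κ}(ω^α_+ / k)`, with `β = 2 (α - κ)`. -/
noncomputable def radialMajorant (β : ℝ) : ℝ → ℝ :=
  (Set.Ioc 0 (1 / 3)).indicator fun r => (r ^ 2 * (-Real.log r) ^ β)⁻¹

theorem radialMajorant_nonneg (β r : ℝ) : 0 ≤ radialMajorant β r :=
  Set.indicator_nonneg (fun r hr => by
    have := one_lt_neg_log hr.1 hr.2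
    positivity) _

theorem integrable_radialMajorant {β : ℝ} (hβ : 1 < β) :
    Integrable fun x : Plane => radialMajorant β ‖x‖ := by
  rw [Plane.integrable_fun_norm]
  have h := (integrable_indicator_iff measurableSet_Ioc).2 (integrableOn_inv_mul_neg_log_rpow hβ)
  refine h.integrableOn.congr_fun (fun r hr => ?_) measurableSet_Ioi
  have hr' : 0 < r := hr
  by_cases hm : r ∈ Set.Ioc 0 (1 / 3 : ℝ)
  · simp only [radialMajorant, Set.indicator_of_mem hm]
    field_simp
  · simp only [radialMajorant, Set.indicator_of_notMem hm, mul_zero]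

theorem zygmundA_mono {p a : ℝ} (hp : 0 ≤ p) (ha : 0 ≤ a) {s t : ℝ} (hs : 0 ≤ s) (hst : s ≤ t) :
    zygmundA p a s ≤ zygmundA p a t := by
  have h1 : 0 ≤ Real.log (2 + s) := Real.log_nonneg (by linarith)
  have h2 : Real.log (2 + s) ≤ Real.log (2 + t) := Real.log_le_log (by linarith) (by linarith)
  unfold zygmundA
  have h3 := hs.trans hst
  gcongr

theorem zygmundA_zero {p a : ℝ} (hp : p ≠ 0) : zygmundA p a 0 = 0 := by
  simp [zygmundA, Real.zero_rpow hp]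

theorem zygmundA_two_zero (s : ℝ) : zygmundA 2 0 s = s ^ 2 := by
  simp [zygmundA]

theorem measurable_zygmundA (p a : ℝ) : Measurable (zygmundA p a) := by
  unfold zygmundA
  exact (measurable_id.mul ((Real.measurable_log.comp
    (measurable_const.add measurable_id)).pow_const a)).pow_const p

theorem exists_zygmundA_omegaPlus_le {α κ : ℝ} (hα : 0 ≤ α) (hκ : 0 ≤ κ) {k : ℝ} (hk : 0 < k) :
    ∃ C : ℝ, ∀ x, zygmundA 2 κ (omegaPlus α x / k) ≤
      C * radialMajorant (2 * (α - κ)) ‖x‖ := by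
  -- Since `s ≤ 1/(k r)`, one has `log (2 + s) ≤ log (2 + 1/k) + L ≤ D L` for `L ≥ 1`. The Zygmund
  -- factor thus only lowers the exponent of `L` from `2α` to `2(α - κ)`.
  set D : ℝ := Real.log (2 + 1 / k) + 1 with hD
  have hD0 : 0 < D := by
    have : 0 < Real.log (2 + 1 / k) := Real.log_pos (by
      have : 0 < 1 / k := by positivity
      linarith)
    linarith
  refine ⟨(k⁻¹ * D ^ κ) ^ 2, fun x => ?_⟩
  by_cases h : x ∈ upperHalfDisk (1 / 3)
  swap
  · rw [omegaPlus_of_notMem α h, zero_div, zygmundA_zero two_ne_zero]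
    exact mul_nonneg (sq_nonneg _) (radialMajorant_nonneg _ _)
  have hr := norm_pos_of_mem_upperHalfDisk h
  have hr3 := h.1.le
  have hL := one_lt_neg_log hr hr3
  rw [omegaPlus_of_mem α h, abs_log_eq hr hr3, radialMajorant,
    Set.indicator_of_mem (show ‖x‖ ∈ Set.Ioc (0 : ℝ) (1 / 3) from ⟨hr, hr3⟩)]
  set r := ‖x‖
  set L := -Real.log r with hLdef
  have hL0 : 0 < L := by linarith
  set s := 1 / (r * L ^ α) / k with hs
  have hs0 : 0 < s := by positivity
  have hsr : s ≤ 1 / k / r := by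
    rw [hs, div_right_comm]
    have h1 : r ≤ r * L ^ α := le_mul_of_one_le_right hr.le (Real.one_le_rpow hL.le hα)
    rw [div_div, div_div]
    gcongr
  have hlog : Real.log (2 + s) ≤ D * L := by
    have h1 : 2 + s ≤ (2 + 1 / k) / r := by
      rw [add_div]
      have : 2 ≤ 2 / r := by rw [le_div_iff₀ hr]; linarith
      linarith
    have h2 := Real.log_le_log (by linarith) h1
    rw [Real.log_div (by positivity) hr.ne'] at h2
    have h3 : 0 ≤ D - 1 := by
      rw [hD, add_sub_cancel_right]
      exact Real.log_nonneg (by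
        have : 0 < 1 / k := by positivity
        linarith)
    have h4 : D - 1 ≤ (D - 1) * L := le_mul_of_one_le_right h3 hL.le
    have h5 : Real.log (2 + 1 / k) = D - 1 := by rw [hD]; ring
    rw [h5] at h2
    nlinarith
  have hlog0 : 0 ≤ Real.log (2 + s) := Real.log_nonneg (by linarith)
  unfold zygmundA
  rw [Real.rpow_two]
  calc (s * Real.log (2 + s) ^ κ) ^ 2 ≤ (s * (D * L) ^ κ) ^ 2 := by gcongr
    _ = (k⁻¹ * D ^ κ) ^ 2 * (r ^ 2 * L ^ (2 * (α - κ)))⁻¹ := by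
      have h6 : L ^ (2 * (α - κ)) = (L ^ α) ^ 2 / (L ^ κ) ^ 2 := by
        rw [mul_comm, Real.rpow_mul hL0.le, Real.rpow_sub hL0, Real.rpow_two, div_pow]
      rw [h6, Real.mul_rpow hD0.le hL0.le, hs]
      field_simp

/-- Allowing any value `s` below `omegaPlus` makes one majorant serve both for membership and for
the truncation errors. -/
theorem exists_integrable_zygmundA_bound {α κ : ℝ} (hκ : 0 ≤ κ) (hακ : κ < α - 1 / 2)
    {k : ℝ} (hk : 0 < k) : ∃ H : Plane → ℝ, Integrable H ∧
      ∀ s x, |s| ≤ omegaPlus α x → zygmundA 2 κ (|s| / k) ≤ H x := by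
  obtain ⟨C, hC⟩ := exists_zygmundA_omegaPlus_le (α := α) (by linarith) hκ hk
  refine ⟨_, (integrable_radialMajorant (β := 2 * (α - κ)) (by linarith)).const_mul C,
    fun s x h => le_trans ?_ (hC x)⟩
  exact zygmundA_mono zero_le_two hκ (by positivity) (by gcongr)

theorem memLp_omegaPlus {α : ℝ} (hα : 1 / 2 < α) : MemLp (omegaPlus α) 2 volume := by
  obtain ⟨H, hH, hb⟩ := exists_integrable_zygmundA_bound (α := α) le_rfl
    (by linarith) one_pos
  rw [memLp_two_iff_integrable_sq (measurable_omegaPlus α).aestronglyMeasurable]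
  refine hH.mono' ((measurable_omegaPlus α).pow_const 2).aestronglyMeasurable
    (Eventually.of_forall fun x => ?_)
  have := hb (omegaPlus α x) x (abs_of_nonneg (omegaPlus_nonneg α x)).le
  rw [div_one, zygmundA_two_zero, sq_abs] at this
  rwa [Real.norm_of_nonneg (by positivity)]

theorem memZygmund_omegaPlus {α κ : ℝ} (hκ : 0 ≤ κ) (hακ : κ < α - 1 / 2) :
    MemZygmund 2 κ (omegaPlus α) := by
  refine ⟨(memLp_omegaPlus (by linarith)).locallyIntegrable (by norm_num), ?_⟩
  obtain ⟨H, hH, hb⟩ := exists_integrable_zygmundA_bound hκ hακ one_pos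
  refine lt_of_le_of_lt (lintegral_mono fun x => ?_) hH.lintegral_lt_top
  have := hb (omegaPlus α x) x (abs_of_nonneg (omegaPlus_nonneg α x)).le
  rw [div_one] at this
  exact ENNReal.ofReal_le_ofReal this

theorem memZygmund_omegaTrunc {α κ : ℝ} (hα : 0 ≤ α) (hκ : 0 ≤ κ) {n : ℕ} (hn : 2 ≤ n) :
    MemZygmund 2 κ (omegaTrunc α n) := by
  refine ⟨(memLp_omegaTrunc hα hn 2).locallyIntegrable (by norm_num), ?_⟩
  set M := max (n : ℝ) (n / |Real.log n| ^ α)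
  have hb : ∀ x, ENNReal.ofReal (zygmundA 2 κ |omegaTrunc α n x|) ≤
      (Metric.closedBall (0 : Plane) (1 / 2)).indicator
        (fun _ => ENNReal.ofReal (zygmundA 2 κ M)) x := by
    intro x
    by_cases hx : x ∈ Metric.closedBall (0 : Plane) (1 / 2)
    · rw [Set.indicator_of_mem hx, abs_of_nonneg (omegaTrunc_nonneg α n x)]
      exact ENNReal.ofReal_le_ofReal
        (zygmundA_mono zero_le_two hκ (omegaTrunc_nonneg α n x) (omegaTrunc_le hα hn x))
    · rw [omegaTrunc_of_half_lt α hn (by simpa using hx), abs_zero, zygmundA_zero two_ne_zero]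
      simp
  refine lt_of_le_of_lt (lintegral_mono hb) ?_
  rw [lintegral_indicator measurableSet_closedBall, setLIntegral_const]
  exact ENNReal.mul_lt_top ENNReal.ofReal_lt_top (isCompact_closedBall _ _).measure_lt_top

/-- The axis is a proper subspace, hence null; discarding it also discards the origin. -/
theorem ae_apply_one_ne_zero : ∀ᵐ x : Plane, x 1 ≠ 0 := by
  have h := Measure.addHaar_submodule (volume : Measure Plane)
    (LinearMap.ker (EuclideanSpace.proj (𝕜 := ℝ) (1 : Fin 2) : Plane →L[ℝ] ℝ).toLinearMap)
    (fun h => by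
      have h1 : (!₂[0, 1] : Plane) ∈ LinearMap.ker
        (EuclideanSpace.proj (𝕜 := ℝ) (1 : Fin 2) : Plane →L[ℝ] ℝ).toLinearMap := h ▸ trivial
      simp at h1)
  rw [ae_iff]
  convert h using 2
  ext x
  simp

theorem ae_abs_sub_le {α : ℝ} (hα1 : α ≤ 1) {n : ℕ} (hn : 4 ≤ n) :
    ∀ᵐ x : Plane, |(omegaTrunc α n - omegaPlus α) x| ≤ omegaPlus α x := by
  filter_upwards [ae_apply_one_ne_zero] with x hx
  have h1 := omegaTrunc_le_omegaPlus hα1 hn hx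
  have h2 := omegaTrunc_nonneg α n x
  rw [Pi.sub_apply, abs_le]
  constructor <;> linarith

/-- Dominated convergence: off the origin the error is eventually zero. Every scale `k` is needed,
because the Luxemburg norm is at most `k` once this integral is at most 1. -/
theorem tendsto_lintegral_zygmundA_sub {α κ : ℝ} (hα1 : α ≤ 1) (hκ : 0 ≤ κ)
    (hακ : κ < α - 1 / 2) {k : ℝ} (hk : 0 < k) :
    Tendsto (fun n : ℕ => ∫⁻ x, ENNReal.ofReal
      (zygmundA 2 κ (|(omegaTrunc α n - omegaPlus α) x| / k))) atTop (𝓝 0) := by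
  obtain ⟨H, hH, hb⟩ := exists_integrable_zygmundA_bound hκ hακ hk
  have hz : (0 : ℝ≥0∞) = ∫⁻ _ : Plane, 0 := by simp
  rw [hz, ← tendsto_add_atTop_iff_nat 4]
  refine tendsto_lintegral_of_dominated_convergence (fun x => ENNReal.ofReal (H x))
    (fun n => ?_) (fun n => ?_) hH.lintegral_lt_top.ne ?_
  · exact ENNReal.measurable_ofReal.comp ((measurable_zygmundA 2 κ).comp
      ((continuous_abs.measurable.comp
        ((measurable_omegaTrunc α _).sub (measurable_omegaPlus α))).div_const k))
  · filter_upwards [ae_abs_sub_le hα1 (Nat.le_add_left 4 n)] with x hx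
    exact ENNReal.ofReal_le_ofReal (hb _ x hx)
  · filter_upwards [ae_apply_one_ne_zero] with x hx
    have hpos : 0 < ‖x‖ := norm_pos_iff.2 fun h => hx (by simp [h])
    have hlim : ∀ᶠ n : ℕ in atTop, 1 / ((n + 4 : ℕ) : ℝ) < ‖x‖ :=
      ((tendsto_const_div_atTop_nhds_zero_nat 1).comp
        (tendsto_add_atTop_nat 4)).eventually (gt_mem_nhds hpos)
    refine tendsto_const_nhds.congr' ?_
    filter_upwards [hlim] with n hn
    rw [Pi.sub_apply, omegaTrunc_of_lt_norm α hn, sub_self, abs_zero, zero_div,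
      zygmundA_zero two_ne_zero, ENNReal.ofReal_zero]

theorem tendsto_luxemburgNorm_sub {α κ : ℝ} (hα1 : α ≤ 1) (hκ : 0 ≤ κ)
    (hακ : κ < α - 1 / 2) :
    Tendsto (fun n : ℕ => luxemburgNorm 2 κ (omegaTrunc α n - omegaPlus α)) atTop (𝓝 0) := by
  rw [ENNReal.tendsto_nhds_zero]
  intro ε hε
  obtain ⟨k, hk0, hkε⟩ := ENNReal.lt_iff_exists_nnreal_btwn.1 hε
  have hk : 0 < k := by exact_mod_cast hk0
  filter_upwards [(tendsto_lintegral_zygmundA_sub hα1 hκ hακ (k := (k : ℝ))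
    hk).eventually (ge_mem_nhds zero_lt_one)] with n hn
  exact (iInf₂_le k ⟨hk, hn⟩).trans hkε.le

theorem tendsto_eLpNorm_sub {α : ℝ} (hα : 1 / 2 < α) (hα1 : α ≤ 1) :
    Tendsto (fun n : ℕ => eLpNorm (omegaTrunc α n - omegaPlus α) 2 volume) atTop (𝓝 0) := by
  -- At `κ = 0`, `k = 1` the integral is the squared `L²` norm.
  have h := tendsto_lintegral_zygmundA_sub hα1 le_rfl (show 0 < α - 1 / 2 by linarith) one_pos
  have h2 := h.ennrpow_const (1 / 2)
  rw [ENNReal.zero_rpow_of_pos (by norm_num)] at h2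
  refine h2.congr fun n => ?_
  rw [eLpNorm_eq_lintegral_rpow_enorm_toReal two_ne_zero ENNReal.ofNat_ne_top]
  simp only [ENNReal.toReal_ofNat]
  congr 1
  refine lintegral_congr fun x => ?_
  rw [div_one, zygmundA_two_zero, ← ofReal_norm, Real.norm_eq_abs,
    ENNReal.ofReal_rpow_of_nonneg (abs_nonneg _) zero_le_two, Real.rpow_two]

/-! ### Lower bound for the horizontal velocity -/

/-- Up to a constant the component is a coordinate of the inversion `a / |a|²`, which distorts
distances by exactly `1 / (|a| |b|)`. -/
theorem abs_biotSavartKernel_sub_le {a b : Plane} (ha : a ≠ 0) (hb : b ≠ 0) :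
    |biotSavartKernel a 0 - biotSavartKernel b 0| ≤
      ‖a - b‖ / (2 * Real.pi * (‖a‖ * ‖b‖)) := by
  have h := dist_div_norm_sq_smul ha hb 1
  rw [dist_eq_norm, dist_eq_norm] at h
  have h1 := Plane.abs_apply_le ((1 / ‖a‖) ^ 2 • a - (1 / ‖b‖) ^ 2 • b) 1
  rw [h] at h1
  have h2 : biotSavartKernel a 0 - biotSavartKernel b 0 =
      -(((1 / ‖a‖) ^ 2 • a - (1 / ‖b‖) ^ 2 • b) 1) / (2 * Real.pi) := by
    rw [biotSavartKernel_zero_apply, biotSavartKernel_zero_apply]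
    have ha' := norm_pos_iff.2 ha
    have hb' := norm_pos_iff.2 hb
    simp only [PiLp.sub_apply, PiLp.smul_apply, smul_eq_mul]
    field_simp
    ring
  rw [h2, abs_div, abs_neg, abs_of_pos Real.two_pi_pos]
  calc _ ≤ 1 ^ 2 / (‖a‖ * ‖b‖) * ‖a - b‖ / (2 * Real.pi) := by gcongr
    _ = _ := by
      have ha' := norm_pos_iff.2 ha
      have hb' := norm_pos_iff.2 hb
      field_simp

/-- A radial error kernel of scale `c`; its integral does not depend on `c > 0`. -/
noncomputable def errorKernel (c : ℝ) (z : Plane) : ℝ := c / (‖z‖ * (c ^ 2 + ‖z‖ ^ 2))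

theorem errorKernel_eq {c : ℝ} (hc : 0 < c) (z : Plane) :
    errorKernel c z = (c ^ 2)⁻¹ * errorKernel 1 (c⁻¹ • z) := by
  unfold errorKernel
  rw [norm_smul, Real.norm_of_nonneg (by positivity)]
  rcases eq_or_ne ‖z‖ 0 with h | h
  · simp [h]
  · field_simp

theorem integrable_errorKernel_one : Integrable (errorKernel 1) := by
  refine (Plane.integrable_fun_norm (f := fun r => 1 / (r * (1 ^ 2 + r ^ 2)))).2 ?_
  refine integrable_inv_one_add_sq.integrableOn.congr_fun (fun r hr => ?_) measurableSet_Ioi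
  have hr' : 0 < r := hr
  field_simp

theorem integrable_errorKernel {c : ℝ} (hc : 0 < c) : Integrable (errorKernel c) := by
  have h := (integrable_errorKernel_one.comp_smul (inv_ne_zero hc.ne')).const_mul ((c ^ 2)⁻¹)
  exact h.congr (Eventually.of_forall fun z => (errorKernel_eq hc z).symm)

theorem integral_errorKernel {c : ℝ} (hc : 0 < c) :
    ∫ z, errorKernel c z = ∫ z, errorKernel 1 z := by
  simp_rw [errorKernel_eq hc]
  rw [integral_const_mul, Measure.integral_comp_smul]
  simp only [finrank_euclideanSpace, Fintype.card_fin, smul_eq_mul]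
  rw [abs_of_nonneg (by positivity)]
  field_simp

/-- The contribution of the vorticity far from the origin to the horizontal velocity at `0`. -/
noncomputable def farField (w : Plane → ℝ) (c : ℝ) : Plane → ℝ :=
  {y | 2 * c < ‖y‖}.indicator fun y => w y * (y 1 / (2 * Real.pi * ‖y‖ ^ 2))

theorem integrable_farField {w : Plane → ℝ} (hw : Integrable w) {c : ℝ} (hc : 0 < c) :
    Integrable (farField w c) := by
  have hS : MeasurableSet {y : Plane | 2 * c < ‖y‖} :=
    measurableSet_lt measurable_const measurable_norm
  refine (hw.norm.mul_const (1 / (2 * Real.pi * (2 * c)))).mono' ?_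
    (Eventually.of_forall fun y => ?_)
  · refine AEStronglyMeasurable.indicator (hw.1.mul ?_) hS
    exact (Plane.measurable_apply_one.div
      (measurable_const.mul (measurable_norm.pow_const 2))).aestronglyMeasurable
  · by_cases hy : y ∈ {y : Plane | 2 * c < ‖y‖}
    · have hy' : 2 * c < ‖y‖ := hy
      have hy0 : 0 < ‖y‖ := by linarith
      rw [farField, Set.indicator_of_mem hy, norm_mul, Real.norm_eq_abs (_ / _), abs_div,
        abs_of_pos (by positivity : 0 < 2 * Real.pi * ‖y‖ ^ 2)]
      refine mul_le_mul_of_nonneg_left ?_ (norm_nonneg _)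
      calc |y 1| / (2 * Real.pi * ‖y‖ ^ 2) ≤ ‖y‖ / (2 * Real.pi * ‖y‖ ^ 2) := by
            gcongr; exact Plane.abs_apply_le y 1
        _ = 1 / (2 * Real.pi * ‖y‖) := by field_simp
        _ ≤ _ := by gcongr
    · rw [farField, Set.indicator_of_notMem hy, norm_zero]
      positivity

/-- For `|y| > 2|x|`, replacing `K(x - y)` by `K(-y)` costs at most `|x| / |y|³`. For `|y| ≤ 2|x|`
the whole term is at most a multiple of `1 / (|y| |x - y|)`, and `|x| ≤ |y| + |x - y|` separates its
singularities at `0` and `x`. -/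
theorem farField_sub_le {w : Plane → ℝ} (h0 : ∀ y, 0 ≤ w y) (h1 : ∀ y, w y * ‖y‖ ≤ 1)
    {x y : Plane} (hx : x ≠ 0) (hy : y ≠ 0) :
    farField w ‖x‖ y - 5 * (errorKernel ‖x‖ y + errorKernel ‖x‖ (x - y)) ≤
      w y * biotSavartKernel (x - y) 0 := by
  have hc : 0 < ‖x‖ := norm_pos_iff.2 hx
  have hd : 0 < ‖y‖ := norm_pos_iff.2 hy
  have hwy : w y ≤ 1 / ‖y‖ := by rw [le_div_iff₀ hd]; exact h1 y
  have hE1 : 0 ≤ errorKernel ‖x‖ y := by unfold errorKernel; positivity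
  have hE2 : 0 ≤ errorKernel ‖x‖ (x - y) := by unfold errorKernel; positivity
  have hpi := Real.pi_gt_three
  by_cases hfar : y ∈ {y : Plane | 2 * ‖x‖ < ‖y‖}
  · have hfar' : 2 * ‖x‖ < ‖y‖ := hfar
    have hxy : ‖y‖ / 2 ≤ ‖x - y‖ := by
      have := norm_sub_norm_le y x
      rw [norm_sub_rev] at this
      linarith
    have hxy0 : x - y ≠ 0 := norm_pos_iff.1 (by linarith)
    have hK := abs_biotSavartKernel_sub_le hxy0 (neg_ne_zero.2 hy)
    rw [norm_neg, sub_neg_eq_add, sub_add_cancel] at hK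
    have hKy : biotSavartKernel (-y) 0 = y 1 / (2 * Real.pi * ‖y‖ ^ 2) := by
      rw [biotSavartKernel_zero_apply, norm_neg, PiLp.neg_apply, neg_neg]
    rw [farField, Set.indicator_of_mem hfar, ← hKy]
    have hK' := neg_le_of_abs_le hK
    have hb : w y * (‖x‖ / (2 * Real.pi * (‖x - y‖ * ‖y‖))) ≤ 5 * errorKernel ‖x‖ y := by
      calc w y * (‖x‖ / (2 * Real.pi * (‖x - y‖ * ‖y‖)))
          ≤ 1 / ‖y‖ * (‖x‖ / (2 * 1 * (‖y‖ / 2 * ‖y‖))) := by gcongr; linarith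
        _ = ‖x‖ / ‖y‖ ^ 3 := by field_simp
        _ ≤ 5 * errorKernel ‖x‖ y := by
          unfold errorKernel
          rw [← mul_div_assoc, div_le_div_iff₀ (by positivity) (by positivity)]
          have : ‖x‖ ^ 2 ≤ ‖y‖ ^ 2 := by gcongr; linarith
          have h3 : ‖x‖ * (‖y‖ * (‖x‖ ^ 2 + ‖y‖ ^ 2)) ≤ ‖x‖ * (‖y‖ * (‖y‖ ^ 2 + ‖y‖ ^ 2)) := by
            gcongr
          have h4 : 0 ≤ ‖x‖ * ‖y‖ ^ 3 := by positivity
          nlinarith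
    have := mul_le_mul_of_nonneg_left hK' (h0 y)
    nlinarith
  · rw [farField, Set.indicator_of_notMem hfar]
    have hnear : ‖y‖ ≤ 2 * ‖x‖ := not_lt.1 hfar
    -- At `y = x` the kernel has the default value 0.
    rcases eq_or_ne (x - y) 0 with hxy | hxy
    · rw [biotSavartKernel_zero_apply, hxy]
      rw [hxy] at hE2
      simp only [PiLp.zero_apply, neg_zero, zero_div, mul_zero]
      linarith
    have he : 0 < ‖x - y‖ := norm_pos_iff.2 hxy
    have he3 : ‖x - y‖ ≤ 3 * ‖x‖ := by linarith [norm_sub_le x y]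
    have hcde : ‖x‖ ≤ ‖y‖ + ‖x - y‖ := by
      have := norm_add_le y (x - y)
      rwa [add_sub_cancel] at this
    have hK : |biotSavartKernel (x - y) 0| ≤ 1 / (2 * Real.pi * ‖x - y‖) := by
      refine (Plane.abs_apply_le _ 0).trans ?_
      rw [norm_biotSavartKernel, one_div]
    have hb : |w y * biotSavartKernel (x - y) 0| ≤
        5 * (errorKernel ‖x‖ y + errorKernel ‖x‖ (x - y)) := by
      rw [abs_mul, abs_of_nonneg (h0 y)]
      -- The 10 is `1 + 3²`, from `|x - y| ≤ 3|x|` in `e2`; here `1 + 2²` would do. Against the 2 in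
      -- the kernel it yields the 5 of the statement.
      have e1 : 1 / (10 * (‖x‖ * ‖y‖)) ≤ errorKernel ‖x‖ y := by
        unfold errorKernel
        rw [div_le_div_iff₀ (by positivity) (by positivity)]
        have : ‖y‖ ^ 2 ≤ (2 * ‖x‖) ^ 2 := by gcongr
        have h5 : ‖y‖ * (‖x‖ ^ 2 + ‖y‖ ^ 2) ≤ ‖y‖ * (‖x‖ ^ 2 + (2 * ‖x‖) ^ 2) := by gcongr
        have h6 : 0 ≤ ‖y‖ * ‖x‖ ^ 2 := by positivity
        nlinarith
      have e2 : 1 / (10 * (‖x‖ * ‖x - y‖)) ≤ errorKernel ‖x‖ (x - y) := by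
        unfold errorKernel
        rw [div_le_div_iff₀ (by positivity) (by positivity)]
        have : ‖x - y‖ ^ 2 ≤ (3 * ‖x‖) ^ 2 := by gcongr
        have h5 : ‖x - y‖ * (‖x‖ ^ 2 + ‖x - y‖ ^ 2) ≤
          ‖x - y‖ * (‖x‖ ^ 2 + (3 * ‖x‖) ^ 2) := by gcongr
        nlinarith
      calc w y * |biotSavartKernel (x - y) 0|
          ≤ 1 / ‖y‖ * (1 / (2 * 1 * ‖x - y‖)) := by
            gcongr
            refine hK.trans ?_
            gcongr
            linarith
        _ = ‖x‖ * (1 / (2 * (‖x‖ * ‖y‖ * ‖x - y‖))) := by field_simp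
        _ ≤ (‖y‖ + ‖x - y‖) * (1 / (2 * (‖x‖ * ‖y‖ * ‖x - y‖))) := by gcongr
        _ = 5 * (1 / (10 * (‖x‖ * ‖y‖)) + 1 / (10 * (‖x‖ * ‖x - y‖))) := by
          field_simp
          ring
        _ ≤ _ := by gcongr
    linarith [neg_le_of_abs_le hb]

/-- Up to a universal constant, the horizontal velocity at `x` created by a nonnegative vorticity
bounded by `1 / |y|` is at least the contribution of the region `|y| > 2 |x|` to that at `0`. -/
theorem exists_farField_le_velocity : ∃ C : ℝ, 0 ≤ C ∧ ∀ w : Plane → ℝ, Integrable w →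
    (∀ y, 0 ≤ w y) → (∀ y, w y * ‖y‖ ≤ 1) → VelocityExists w → ∀ x : Plane, x ≠ 0 →
    (∫ y, farField w ‖x‖ y) - C ≤ velocity w x 0 := by
  -- Two error kernels with factor 5, whose integrals are the same for every `x` by scaling.
  refine ⟨10 * ∫ z, errorKernel 1 z, ?_, fun w hw h0 h1 hv x hx => ?_⟩
  · exact mul_nonneg (by norm_num) (integral_nonneg fun z => by unfold errorKernel; positivity)
  have hc : 0 < ‖x‖ := norm_pos_iff.2 hx
  have hI : Integrable fun y => w y • biotSavartKernel (x - y) := hv x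
  have hvel : velocity w x 0 = ∫ y, w y * biotSavartKernel (x - y) 0 := by
    rw [velocity_apply]
    exact ((EuclideanSpace.proj (𝕜 := ℝ) (0 : Fin 2) : Plane →L[ℝ] ℝ).integral_comp_comm hI).symm
  have hI0 : Integrable fun y => w y * biotSavartKernel (x - y) 0 :=
    (EuclideanSpace.proj (𝕜 := ℝ) (0 : Fin 2) : Plane →L[ℝ] ℝ).integrable_comp hI
  have hE := integrable_errorKernel hc
  have hE' := hE.comp_sub_left x
  have hsum : Integrable fun y => 5 * (errorKernel ‖x‖ y + errorKernel ‖x‖ (x - y)) :=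
    (hE.add hE').const_mul 5
  have hF := integrable_farField hw hc
  rw [hvel]
  calc (∫ y, farField w ‖x‖ y) - 10 * ∫ z, errorKernel 1 z
      = ∫ y, (farField w ‖x‖ y - 5 * (errorKernel ‖x‖ y + errorKernel ‖x‖ (x - y))) := by
        rw [integral_sub hF hsum, integral_const_mul, integral_add hE hE',
          integral_sub_left_eq_self (errorKernel ‖x‖), integral_errorKernel hc]
        ring
    _ ≤ _ := by
      refine integral_mono_ae (hF.sub hsum) hI0 ?_
      filter_upwards [ae_apply_one_ne_zero] with y hy
      exact farField_sub_le h0 h1 hx fun h => hy (by simp [h])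

/-- Lower bound for an integral over the upper half plane by a one-dimensional integral. -/
theorem Plane.two_mul_integral_le {F : Plane → ℝ} (hF : Integrable F) (hF0 : ∀ x, 0 ≤ F x)
    {f : ℝ → ℝ} {a b : ℝ} (ha : 0 < a) (hab : a ≤ b) (hf : ContinuousOn f (Set.Icc a b))
    (hf0 : ∀ r ∈ Set.Ioo a b, 0 ≤ f r)
    (hFf : ∀ x : Plane, 0 < x 1 → a < ‖x‖ → ‖x‖ < b → x 1 / ‖x‖ * (f ‖x‖ / ‖x‖) ≤ F x) :
    2 * ∫ r in a..b, f r ≤ ∫ x, F x := by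
  set g : ℝ → ℝ≥0∞ := (Set.Ioo a b).indicator fun r => ENNReal.ofReal (f r / r) with hg
  have hfi : IntegrableOn f (Set.Ioo a b) :=
    (hf.integrableOn_Icc).mono_set Set.Ioo_subset_Icc_self
  have hgm : Measurable g := by
    have hcont : ContinuousOn (fun r => ENNReal.ofReal (f r / r)) (Set.Ioo a b) := by
      refine ENNReal.continuous_ofReal.comp_continuousOn ?_
      exact (hf.mono Set.Ioo_subset_Icc_self).div continuousOn_id
        fun r hr => (ha.trans hr.1).ne'
    classical
    rw [hg, ← Set.piecewise_eq_indicator]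
    exact hcont.measurable_piecewise continuousOn_const measurableSet_Ioo
  have h1 : ∫⁻ r in Set.Ioi 0, ENNReal.ofReal r * g r =
      ENNReal.ofReal (∫ r in a..b, f r) := by
    rw [intervalIntegral.integral_of_le hab, integral_Ioc_eq_integral_Ioo,
      ofReal_integral_eq_lintegral_ofReal hfi
        ((ae_restrict_iff' measurableSet_Ioo).2 (Eventually.of_forall hf0)),
      ← lintegral_indicator measurableSet_Ioi, ← lintegral_indicator measurableSet_Ioo]
    refine lintegral_congr fun r => ?_
    by_cases hr : r ∈ Set.Ioo a b
    · have hr0 : 0 < r := ha.trans hr.1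
      rw [Set.indicator_of_mem hr, Set.indicator_of_mem (show r ∈ Set.Ioi 0 from hr0), hg,
        Set.indicator_of_mem hr, ← ENNReal.ofReal_mul hr0.le]
      congr 1
      field_simp
    · rw [Set.indicator_of_notMem hr]
      refine Set.indicator_apply_eq_zero.2 fun _ => ?_
      rw [hg, Set.indicator_of_notMem hr, mul_zero]
  have h2 := Plane.two_mul_lintegral_le hgm
  have h3 : ∫⁻ x in {x : Plane | 0 < x 1}, ENNReal.ofReal (x 1 / ‖x‖) * g ‖x‖ ≤
      ENNReal.ofReal (∫ x, F x) := by
    rw [ofReal_integral_eq_lintegral_ofReal hF (Eventually.of_forall hF0)]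
    refine le_trans ?_ (setLIntegral_le_lintegral {x : Plane | 0 < x 1} _)
    refine setLIntegral_mono' (measurableSet_lt measurable_const Plane.measurable_apply_one)
      fun x hx => ?_
    have hx' : 0 < x 1 := hx
    by_cases hr : ‖x‖ ∈ Set.Ioo a b
    · rw [hg, Set.indicator_of_mem hr, ← ENNReal.ofReal_mul (by positivity)]
      exact ENNReal.ofReal_le_ofReal (hFf x hx hr.1 hr.2)
    · rw [hg, Set.indicator_of_notMem hr, mul_zero]
      exact zero_le
  rw [h1] at h2
  have h4 := h2.trans h3
  have hI : 0 ≤ ∫ x, F x := integral_nonneg hF0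
  have h5 : (2 : ℝ≥0∞) * ENNReal.ofReal (∫ r in a..b, f r) =
      ENNReal.ofReal (2 * ∫ r in a..b, f r) := by
    rw [ENNReal.ofReal_mul zero_le_two, ENNReal.ofReal_ofNat]
  rw [h5] at h4
  exact (ENNReal.ofReal_le_ofReal_iff hI).1 h4

theorem integrable_omegaTrunc {α : ℝ} (hα : 0 ≤ α) {n : ℕ} (hn : 2 ≤ n) :
    Integrable (omegaTrunc α n) :=
  memLp_one_iff_integrable.1 (memLp_omegaTrunc hα hn 1)

theorem velocityExists_omegaTrunc {α : ℝ} (hα : 0 ≤ α) {n : ℕ} (hn : 2 ≤ n) :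
    VelocityExists (omegaTrunc α n) :=
  velocityExists_of_memLp (p := ∞) (by simp) (memLp_omegaTrunc hα hn ∞)
    (hasCompactSupport_omegaTrunc α hn)

theorem integrable_transportTerm_omegaTrunc {α : ℝ} (hα : 0 ≤ α) {n : ℕ} (hn : 2 ≤ n) :
    Integrable (transportTerm (omegaTrunc α n)) :=
  integrable_transportTerm (p := ∞) (by simp) (memLp_omegaTrunc hα hn ∞)
    (hasCompactSupport_omegaTrunc α hn)

theorem transportTerm_zero_apply (ω : Plane → ℝ) (x : Plane) :
    transportTerm ω x 0 = velocity ω x 0 * |ω x| ^ 2 := by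
  simp [transportTerm, mul_comm]

theorem integrable_velocity_mul_sq {α : ℝ} (hα : 0 ≤ α) {n : ℕ} (hn : 2 ≤ n) :
    Integrable (fun x => velocity (omegaTrunc α n) x 0 * |omegaTrunc α n x| ^ 2) := by
  simp_rw [← transportTerm_zero_apply]
  exact (EuclideanSpace.proj (𝕜 := ℝ) (0 : Fin 2) : Plane →L[ℝ] ℝ).integrable_comp
    (integrable_transportTerm_omegaTrunc hα hn)

theorem farField_omegaTrunc_nonneg (α : ℝ) (n : ℕ) (c : ℝ) (y : Plane) :
    0 ≤ farField (omegaTrunc α n) c y := by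
  refine Set.indicator_nonneg (fun y _ => ?_) y
  rcases lt_or_ge (y 1) 0 with h | h
  · rw [omegaTrunc_of_neg α n h, zero_mul]
  · exact mul_nonneg (omegaTrunc_nonneg α n y) (by positivity)

/-- On `2c < |y| < 1/3` the vorticity is at least `L^(-α) / |y|` with `L = |log c|`, so integrating
gives `π⁻¹ L^(-α) (L - log 6)`. The loss is at most 1 because `log 6 ≤ 3 < π`. -/
theorem le_integral_farField {α : ℝ} (hα : 0 ≤ α) {n : ℕ} (hn : 2 ≤ n) {c : ℝ}
    (hnc : 1 / (n : ℝ) ≤ c) (hc : c < 1 / 3) :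
    Real.pi⁻¹ * (-Real.log c) ^ (1 - α) - 1 ≤ ∫ y, farField (omegaTrunc α n) c y := by
  have hn0 : (0 : ℝ) < n := by exact_mod_cast (by omega : 0 < n)
  have hc0 : 0 < c := lt_of_lt_of_le (by positivity) hnc
  have hL := one_lt_neg_log hc0 hc.le
  set L := -Real.log c with hLdef
  have hL0 : 0 < L := by linarith
  have hpi := Real.pi_gt_three
  have hsplit : L ^ (1 - α) = L ^ (-α) * L := by
    rw [sub_eq_neg_add, Real.rpow_add hL0, Real.rpow_one]
  have hLα : L ^ (-α) ≤ 1 := Real.rpow_le_one_of_one_le_of_nonpos hL.le (by linarith)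
  have hLα0 : 0 < L ^ (-α) := by positivity
  have hlog6 : Real.log 6 ≤ 3 := by
    rw [Real.log_le_iff_le_exp (by norm_num)]
    have h1 := Real.exp_one_gt_d9
    have h2 : Real.exp 3 = Real.exp 1 ^ 3 := by rw [← Real.exp_nat_mul]; norm_num
    rw [h2]
    calc (6 : ℝ) ≤ 2 ^ 3 := by norm_num
      _ ≤ Real.exp 1 ^ 3 := by gcongr; linarith
  have hlog60 : 0 ≤ Real.log 6 := Real.log_nonneg (by norm_num)
  have key : Real.pi⁻¹ * (L ^ (-α) * (L - Real.log 6)) ≤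
      ∫ y, farField (omegaTrunc α n) c y := by
    -- For `c ≥ 1/6` the annulus is empty and the left side is nonpositive.
    rcases le_or_gt (1 / 6) c with h6 | h6
    · have h7 : L ≤ Real.log 6 := by
        have := Real.log_le_log (by norm_num) h6
        rw [one_div, Real.log_inv] at this
        linarith
      have : Real.pi⁻¹ * (L ^ (-α) * (L - Real.log 6)) ≤ 0 :=
        mul_nonpos_of_nonneg_of_nonpos (by positivity)
          (mul_nonpos_of_nonneg_of_nonpos hLα0.le (by linarith))
      exact this.trans (integral_nonneg (farField_omegaTrunc_nonneg α n c))
    · have hint : ∫ r in (2 * c)..(1 / 3), L ^ (-α) / (2 * Real.pi) * r⁻¹ =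
          L ^ (-α) / (2 * Real.pi) * (L - Real.log 6) := by
        rw [intervalIntegral.integral_const_mul, integral_inv_of_pos (by linarith) (by norm_num)]
        congr 1
        rw [show (1 / 3 / (2 * c)) = (6 * c)⁻¹ by field_simp; norm_num, Real.log_inv,
          Real.log_mul (by norm_num) hc0.ne']
        ring
      have h8 := Plane.two_mul_integral_le
        (integrable_farField (integrable_omegaTrunc hα hn) hc0)
        (farField_omegaTrunc_nonneg α n c) (f := fun r => L ^ (-α) / (2 * Real.pi) * r⁻¹)
        (a := 2 * c) (b := 1 / 3) (by linarith) (by linarith)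
        (continuousOn_const.mul (continuousOn_inv₀.mono fun r hr => ne_of_gt (by
          have := hr.1
          linarith)))
        (fun r hr => by
          have : 0 < r := by linarith [hr.1]
          positivity)
        (fun y hy h1 h2 => by
          have hmem : y ∈ upperHalfDisk (1 / 3) := ⟨h2, hy⟩
          have hy0 := norm_pos_of_mem_upperHalfDisk hmem
          have hLy := one_lt_neg_log hy0 h2.le
          rw [farField, Set.indicator_of_mem (show y ∈ {y : Plane | 2 * c < ‖y‖} from h1), omegaTrunc_of_lt_norm α (by linarith),
            omegaPlus_of_mem α hmem, abs_log_eq hy0 h2.le]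
          have hle : -Real.log ‖y‖ ≤ L := neg_le_neg (Real.log_le_log hc0 (by linarith))
          have hle2 : L ^ (-α) ≤ 1 / (-Real.log ‖y‖) ^ α := by
            rw [Real.rpow_neg hL0.le, one_div]
            have : 0 < (-Real.log ‖y‖) ^ α := Real.rpow_pos_of_pos (by linarith) _
            gcongr
          calc y 1 / ‖y‖ * (L ^ (-α) / (2 * Real.pi) * ‖y‖⁻¹ / ‖y‖)
              = L ^ (-α) / ‖y‖ * (y 1 / (2 * Real.pi * ‖y‖ ^ 2)) := by field_simp
            _ ≤ 1 / (-Real.log ‖y‖) ^ α / ‖y‖ * (y 1 / (2 * Real.pi * ‖y‖ ^ 2)) := by gcongr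
            _ = _ := by rw [div_div, mul_comm ‖y‖])
      rw [hint] at h8
      refine le_trans (le_of_eq ?_) h8
      field_simp
  refine le_trans ?_ key
  rw [hsplit, mul_sub, mul_sub]
  have h9 : Real.pi⁻¹ * (L ^ (-α) * Real.log 6) ≤ 3⁻¹ * (1 * 3) := by gcongr
  linarith

theorem exists_le_velocity_omegaTrunc {α : ℝ} (hα : 0 ≤ α) : ∃ C : ℝ, 0 ≤ C ∧
    ∀ n : ℕ, 4 ≤ n → ∀ x : Plane, x ≠ 0 → -C ≤ velocity (omegaTrunc α n) x 0 ∧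
      (1 / (n : ℝ) < ‖x‖ → ‖x‖ < 1 / 3 →
        Real.pi⁻¹ * (-Real.log ‖x‖) ^ (1 - α) - C ≤ velocity (omegaTrunc α n) x 0) := by
  obtain ⟨C, hC, h⟩ := exists_farField_le_velocity
  refine ⟨C + 1, by linarith, fun n hn x hx => ?_⟩
  have h1 := h (omegaTrunc α n) (integrable_omegaTrunc hα (by omega)) (omegaTrunc_nonneg α n)
    (omegaTrunc_mul_norm_le hα (by omega)) (velocityExists_omegaTrunc hα (by omega)) x hx
  refine ⟨?_, fun h2 h3 => ?_⟩
  · have : 0 ≤ ∫ y, farField (omegaTrunc α n) ‖x‖ y :=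
      integral_nonneg (farField_omegaTrunc_nonneg α n ‖x‖)
    linarith
  · linarith [le_integral_farField hα (by omega : 2 ≤ n) h2.le h3]

/-! ### Divergence of the integral -/

/-- The singular density `1 / (|x|² |log |x||)` on the upper half of an annulus. -/
noncomputable def annulusDensity (a : ℝ) : Plane → ℝ :=
  ({x | a < ‖x‖} ∩ upperHalfDisk (1 / 3)).indicator fun x => (‖x‖ ^ 2 * -Real.log ‖x‖)⁻¹

theorem annulusDensity_nonneg (a : ℝ) (x : Plane) : 0 ≤ annulusDensity a x :=
  Set.indicator_nonneg (fun x hx => by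
    have h0 := norm_pos_of_mem_upperHalfDisk hx.2
    have := one_lt_neg_log h0 hx.2.1.le
    positivity) x

theorem integrable_annulusDensity {a : ℝ} (ha : 0 < a) : Integrable (annulusDensity a) := by
  have hS : MeasurableSet ({x : Plane | a < ‖x‖} ∩ upperHalfDisk (1 / 3)) :=
    (measurableSet_lt measurable_const measurable_norm).inter (measurableSet_upperHalfDisk _)
  have hfin : volume ({x : Plane | a < ‖x‖} ∩ upperHalfDisk (1 / 3)) ≠ ∞ := by
    refine ((measure_mono fun x hx => ?_).trans_lt
      (isCompact_closedBall (0 : Plane) (1 / 3)).measure_lt_top).ne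
    rw [mem_closedBall_zero_iff]
    exact hx.2.1.le
  rw [annulusDensity, integrable_indicator_iff hS]
  refine Measure.integrableOn_of_bounded (M := (a ^ 2)⁻¹) hfin ?_ ?_
  · exact (((measurable_norm.pow_const 2).mul
      (Real.measurable_log.comp measurable_norm).neg).inv).aestronglyMeasurable
  · refine (ae_restrict_iff' hS).2 (Eventually.of_forall fun x hx => ?_)
    have h0 := norm_pos_of_mem_upperHalfDisk hx.2
    have hL := one_lt_neg_log h0 hx.2.1.le
    have hx1 : a < ‖x‖ := hx.1
    rw [Real.norm_of_nonneg (by positivity)]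
    gcongr
    calc a ^ 2 ≤ ‖x‖ ^ 2 := by gcongr
      _ ≤ _ := le_mul_of_one_le_right (by positivity) hL.le

theorem le_integral_annulusDensity {a : ℝ} (ha : 0 < a) (ha3 : a ≤ 1 / 3) :
    2 * (Real.log (-Real.log a) - Real.log (-Real.log (1 / 3))) ≤ ∫ x, annulusDensity a x := by
  have hcont : ContinuousOn (fun r : ℝ => (r * -Real.log r)⁻¹) (Set.Icc a (1 / 3)) := by
    have h1 : ContinuousOn Real.log (Set.Icc a (1 / 3)) :=
      Real.continuousOn_log.mono fun r hr => (ha.trans_le hr.1).ne'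
    refine (continuousOn_id.mul h1.neg).inv₀ fun r hr => ?_
    have h0 : 0 < r := ha.trans_le hr.1
    have := one_lt_neg_log h0 hr.2
    exact mul_ne_zero h0.ne' (by simp only [Pi.neg_apply]; linarith)
  have hint : ∫ r in a..(1 / 3), (r * -Real.log r)⁻¹ =
      Real.log (-Real.log a) - Real.log (-Real.log (1 / 3)) := by
    have h := intervalIntegral.integral_eq_sub_of_hasDerivAt
      (f := fun r => -Real.log (-Real.log r)) (f' := fun r => (r * -Real.log r)⁻¹)
      (a := a) (b := 1 / 3) ?_ ?_
    · rw [h]; ring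
    · intro r hr
      rw [Set.uIcc_of_le ha3] at hr
      have h0 : 0 < r := ha.trans_le hr.1
      have hL := one_lt_neg_log h0 hr.2
      have h1 := ((Real.hasDerivAt_log h0.ne').fun_neg.log (by linarith)).fun_neg
      have h2 : -(-r⁻¹ / -Real.log r) = (r * -Real.log r)⁻¹ := by
        rw [mul_inv, neg_div, neg_neg, div_eq_mul_inv]
      rw [← h2]
      exact h1
    · refine ContinuousOn.intervalIntegrable ?_
      rwa [Set.uIcc_of_le ha3]
  rw [← hint]
  refine Plane.two_mul_integral_le (integrable_annulusDensity ha) (annulusDensity_nonneg a) ha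
    ha3 hcont (fun r hr => ?_) fun x hx h1 h2 => ?_
  · have h0 : 0 < r := ha.trans hr.1
    have := one_lt_neg_log h0 hr.2.le
    positivity
  · have hmem : x ∈ upperHalfDisk (1 / 3) := ⟨h2, hx⟩
    have h0 := norm_pos_of_mem_upperHalfDisk hmem
    have hL := one_lt_neg_log h0 h2.le
    rw [annulusDensity, Set.indicator_of_mem
      (show x ∈ {x : Plane | a < ‖x‖} ∩ upperHalfDisk (1 / 3) from ⟨h1, hmem⟩)]
    -- The factor `sin θ` is inserted only to reuse the polar bound; it costs a constant.
    have h3 : x 1 / ‖x‖ ≤ 1 := by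
      rw [div_le_one h0]; exact (le_abs_self _).trans (Plane.abs_apply_le x 1)
    calc x 1 / ‖x‖ * ((‖x‖ * -Real.log ‖x‖)⁻¹ / ‖x‖)
        ≤ 1 * ((‖x‖ * -Real.log ‖x‖)⁻¹ / ‖x‖) := by gcongr
      _ = _ := by
        rw [one_mul, mul_inv, mul_inv]
        field_simp

theorem tendsto_integral_velocity_mul_sq {α : ℝ} (hα : 1 / 2 < α) (hα2 : α ≤ 2 / 3) :
    Tendsto (fun n : ℕ => ∫ x, velocity (omegaTrunc α n) x 0 * |omegaTrunc α n x| ^ 2)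
      atTop atTop := by
  obtain ⟨C, hC, h⟩ := exists_le_velocity_omegaTrunc (α := α) (by linarith)
  have hsq : Integrable fun x => omegaPlus α x ^ 2 := (memLp_omegaPlus hα).integrable_sq
  -- On the annulus the sharp velocity bound gives the singular density; elsewhere `u₁ ≥ -C`
  -- suffices. The cost is at most `C ∫ (ω^α_+)²`, uniformly in `n`.
  have hlow : ∀ n : ℕ, 4 ≤ n →
      Real.pi⁻¹ * (2 * (Real.log (Real.log n) - Real.log (-Real.log (1 / 3)))) -
        C * ∫ x, omegaPlus α x ^ 2 ≤
      ∫ x, velocity (omegaTrunc α n) x 0 * |omegaTrunc α n x| ^ 2 := by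
    intro n hn
    have hn' : (4 : ℝ) ≤ n := by exact_mod_cast hn
    have hn0 : 0 < 1 / (n : ℝ) := by positivity
    have hn3 : 1 / (n : ℝ) ≤ 1 / 3 := one_div_le_one_div_of_le (by norm_num) (by linarith)
    have hJ := le_integral_annulusDensity hn0 hn3
    rw [one_div (n : ℝ), Real.log_inv, neg_neg] at hJ
    have hJi := (integrable_annulusDensity (inv_pos.2 (by linarith : (0 : ℝ) < n))).const_mul
      Real.pi⁻¹
    calc _ ≤ Real.pi⁻¹ * (∫ x, annulusDensity (n : ℝ)⁻¹ x) - C * ∫ x, omegaPlus α x ^ 2 := by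
          gcongr
      _ = ∫ x, (Real.pi⁻¹ * annulusDensity (n : ℝ)⁻¹ x - C * omegaPlus α x ^ 2) := by
        rw [integral_sub hJi (hsq.const_mul C), integral_const_mul, integral_const_mul]
      _ ≤ _ := by
        refine integral_mono_ae (hJi.sub (hsq.const_mul C))
          (integrable_velocity_mul_sq (by linarith) (by omega)) ?_
        filter_upwards [ae_apply_one_ne_zero] with x hx
        obtain ⟨hv1, hv2⟩ := h n hn x fun h' => hx (by simp [h'])
        have hw0 := omegaTrunc_nonneg α n x
        have hw1 := omegaTrunc_le_omegaPlus (α := α) (by linarith) hn hx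
        rw [sq_abs]
        by_cases hmem : x ∈ {x : Plane | (n : ℝ)⁻¹ < ‖x‖} ∩ upperHalfDisk (1 / 3)
        · have hnx : 1 / (n : ℝ) < ‖x‖ := by rw [one_div]; exact hmem.1
          have hr := norm_pos_of_mem_upperHalfDisk hmem.2
          have hL := one_lt_neg_log hr hmem.2.1.le
          have hv := hv2 hnx hmem.2.1
          rw [annulusDensity, Set.indicator_of_mem hmem, omegaTrunc_of_lt_norm α hnx,
            omegaPlus_of_mem α hmem.2, abs_log_eq hr hmem.2.1.le]
          set L := -Real.log ‖x‖
          have hL0 : 0 < L := by linarith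
          -- This is `1 - 3α ≥ -1`, that is, `α ≤ 2/3`.
          have h1 : (‖x‖ ^ 2 * L)⁻¹ ≤ L ^ (1 - α) * (1 / (‖x‖ * L ^ α)) ^ 2 := by
            have h2 : L ^ (1 - α) * (1 / (‖x‖ * L ^ α)) ^ 2 =
                (‖x‖ ^ 2)⁻¹ * L ^ (1 - 3 * α) := by
              have h3 : L ^ (1 - 3 * α) = L ^ (1 - α) / (L ^ α) ^ 2 := by
                rw [← Real.rpow_natCast, ← Real.rpow_mul hL0.le, ← Real.rpow_sub hL0]
                congr 1
                push_cast
                ring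
              rw [h3]
              field_simp
            rw [h2, mul_inv]
            gcongr
            rw [← Real.rpow_neg_one]
            exact Real.rpow_le_rpow_of_exponent_le hL.le (by linarith)
          have h4 := mul_le_mul_of_nonneg_right hv (sq_nonneg (1 / (‖x‖ * L ^ α)))
          have h5 := mul_le_mul_of_nonneg_left h1 (inv_nonneg.2 Real.pi_pos.le)
          nlinarith
        · rw [annulusDensity, Set.indicator_of_notMem hmem, mul_zero, zero_sub]
          have h6 : omegaTrunc α n x ^ 2 ≤ omegaPlus α x ^ 2 := by gcongr
          nlinarith [sq_nonneg (omegaTrunc α n x)]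
  have hlim : Tendsto (fun n : ℕ =>
      Real.pi⁻¹ * (2 * (Real.log (Real.log n) - Real.log (-Real.log (1 / 3)))) -
        C * ∫ x, omegaPlus α x ^ 2) atTop atTop := by
    refine tendsto_atTop_add_const_right _ _ ?_
    refine Tendsto.const_mul_atTop (inv_pos.2 Real.pi_pos) (Tendsto.const_mul_atTop two_pos ?_)
    refine tendsto_atTop_add_const_right _ _ ?_
    exact Real.tendsto_log_atTop.comp (Real.tendsto_log_atTop.comp tendsto_natCast_atTop_atTop)
  refine tendsto_atTop_mono' _ ?_ hlim
  filter_upwards [eventually_ge_atTop 4] with n hn using hlow n hn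

/-! ### Nonexistence of a continuous extension -/

theorem exists_testFunction_eq_one :
    ∃ φ : 𝓓((⊤ : TopologicalSpace.Opens Plane), ℝ), ∀ x : Plane, ‖x‖ ≤ 1 / 2 → φ x = 1 := by
  let b : ContDiffBump (0 : Plane) := ⟨1 / 2, 1, by norm_num, by norm_num⟩
  refine ⟨⟨b, b.contDiff, b.hasCompactSupport, fun _ _ => trivial⟩, fun x hx => ?_⟩
  exact b.one_of_mem_closedBall (by simpa [b] using hx)

/-- If the truncations converge to `ω^α_+` in a space, then `ω ↦ u |ω|²` has no continuous
extension to the elements of that space with compact support. -/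
theorem not_exists_isContinuousExtension {α : ℝ} (hα : 1 / 2 < α) (hα2 : α ≤ 2 / 3) (p : ℝ≥0∞)
    {Mem : (Plane → ℝ) → Prop} {N : (Plane → ℝ) → ℝ≥0∞}
    (hplus : Mem (omegaPlus α)) (htrunc : ∀ n : ℕ, 2 ≤ n → Mem (omegaTrunc α n))
    (hlim : Tendsto (fun n : ℕ => N (omegaTrunc α n - omegaPlus α)) atTop (𝓝 0)) :
    ¬ ∃ T, IsContinuousExtension p Mem N T := by
  rintro ⟨T, hT, hcont⟩
  obtain ⟨φ, hφ⟩ := exists_testFunction_eq_one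
  have hα0 : 0 ≤ α := by linarith
  have h := hcont (fun n => omegaTrunc α (n + 2)) (omegaPlus α) (Metric.closedBall 0 (1 / 2))
    (isCompact_closedBall _ _)
    (fun n => ⟨htrunc _ (by omega), tsupport_omegaTrunc α (by omega)⟩) hplus
    (tsupport_omegaPlus α) (hlim.comp (tendsto_add_atTop_nat 2)) φ
  let π₀ : Plane →L[ℝ] ℝ := EuclideanSpace.proj (𝕜 := ℝ) (0 : Fin 2)
  have h0 := (π₀.continuous.tendsto _).comp h
  have heq : ∀ n : ℕ, π₀ (T (omegaTrunc α (n + 2)) φ) =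
      ∫ x, velocity (omegaTrunc α (n + 2)) x 0 * |omegaTrunc α (n + 2) x| ^ 2 := by
    intro n
    have hn : 2 ≤ n + 2 := by omega
    rw [hT _ (htrunc _ hn) (hasCompactSupport_omegaTrunc α hn) (memLp_omegaTrunc hα0 hn p)]
    -- The cutoff is 1 on the ball containing every support, so the pairing is the full integral.
    have hφ' : ∀ x, φ x • transportTerm (omegaTrunc α (n + 2)) x =
        transportTerm (omegaTrunc α (n + 2)) x := by
      intro x
      rcases le_or_gt ‖x‖ (1 / 2) with hx | hx
      · rw [hφ x hx, one_smul]
      · simp [transportTerm, omegaTrunc_of_half_lt α hn hx]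
    simp_rw [hφ', ← transportTerm_zero_apply]
    exact (π₀.integral_comp_comm (integrable_transportTerm_omegaTrunc hα0 hn)).symm
  have htop := (tendsto_integral_velocity_mul_sq hα hα2).comp (tendsto_add_atTop_nat 2)
  exact not_tendsto_nhds_of_tendsto_atTop htop _ (h0.congr heq)

theorem theorem5p4 :
    (∀ α : ℝ, 1 / 2 < α → α ≤ 2 / 3 →
      -- strong convergence of the truncations in `L² (log L)^κ`
      (∀ κ : ℝ, 0 ≤ κ → κ < α - 1 / 2 →
        MemZygmund 2 κ (omegaPlus α) ∧
        (∀ n : ℕ, 2 ≤ n → MemZygmund 2 κ (omegaTrunc α n)) ∧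
        Tendsto (fun n : ℕ => luxemburgNorm 2 κ (omegaTrunc α n - omegaPlus α)) atTop (𝓝 0)) ∧
      -- blow-up of `∫ u^n_1 |ω^n_+|²`, all the integrals being absolutely convergent
      (∀ n : ℕ, 2 ≤ n →
        VelocityExists (omegaTrunc α n) ∧
        Integrable (fun x => velocity (omegaTrunc α n) x 0 * |omegaTrunc α n x| ^ 2) volume) ∧
      Tendsto (fun n : ℕ => ∫ x, velocity (omegaTrunc α n) x 0 * |omegaTrunc α n x| ^ 2)
        atTop atTop) ∧
    (∀ p : ℝ≥0∞, 2 < p →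
      -- `ω ↦ u |ω|²` is well defined from `L^p_c` to the distributions
      (∀ ω : Plane → ℝ, MemLp ω p volume → HasCompactSupport ω →
        VelocityExists ω ∧ LocallyIntegrable (transportTerm ω) volume) ∧
      -- it has no continuous extension to `(L² (log L)^κ)_c` with `0 ≤ κ < 1/6`, nor to `L²_c`
      (∀ κ : ℝ, 0 ≤ κ → κ < 1 / 6 →
        ¬ ∃ T, IsContinuousExtension p (MemZygmund 2 κ) (luxemburgNorm 2 κ) T) ∧
      ¬ ∃ T, IsContinuousExtension p (fun f => MemLp f 2 volume)
        (fun f => eLpNorm f 2 volume) T) := by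
  refine ⟨fun α hα hα2 => ⟨fun κ hκ hκα => ⟨memZygmund_omegaPlus hκ hκα,
    fun n hn => memZygmund_omegaTrunc (by linarith) hκ hn,
    tendsto_luxemburgNorm_sub (by linarith) hκ hκα⟩,
    fun n hn => ⟨velocityExists_omegaTrunc (by linarith) hn,
      integrable_velocity_mul_sq (by linarith) hn⟩,
    tendsto_integral_velocity_mul_sq hα hα2⟩, fun p hp => ⟨fun ω hω hc =>
    ⟨velocityExists_of_memLp hp hω hc, (integrable_transportTerm hp hω hc).locallyIntegrable⟩,
    fun κ hκ hκ6 => ?_, ?_⟩⟩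
  -- The largest admissible `α` gives the widest range of `κ`: `2/3 - 1/2 = 1/6`.
  · have hκ' : κ < 2 / 3 - 1 / 2 := by linarith
    exact not_exists_isContinuousExtension (α := 2 / 3) (by norm_num) le_rfl p
      (memZygmund_omegaPlus hκ hκ')
      (fun n hn => memZygmund_omegaTrunc (by norm_num) hκ hn)
      (tendsto_luxemburgNorm_sub (by norm_num) hκ hκ')
  · exact not_exists_isContinuousExtension (α := 2 / 3) (by norm_num) le_rfl p
      (memLp_omegaPlus (by norm_num))
      (fun n hn => memLp_omegaTrunc (by norm_num) hn 2)
      (tendsto_eLpNorm_sub (by norm_num) (by norm_num))
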